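/- Let $I=(0,1]$ with Lebesgue measure $\lambda$. An ideal in $L^1(I)$ is a vector space $X$ with $L^\infty(I)\subseteq X\subseteq L^1(I)$ such that $x\in X$, $y\in L^1(I)$, $|y|\le |x|$ a.e. imply $y\in X$. It is symmetric if $x\in X$, $y\in L^1(I)$, $y^*\le x^*$ imply $y\in X$, where $f^*$ is the right-continuous non-increasing rearrangement of $|f|$. It is majorant if $TX\subseteq X$ for every bounded linear operator $T:L^1(I)\to L^1(I)$ with $T(L^\infty(I))\subseteq L^\infty(I)$. Let $1=t_0>t_1>t_2>\cdots$ with $t_n\to 0$, let $a_n=t_{n-1}-t_n$ for $n\ge 1$, and let $\mathcal T$ be the $\sigma$-algebra generated by the intervals $(t_n,t_{n-1}]$, $n\ge 1$, and the null sets (the interval partition $(t_n)$, with stochastic vector $(a_n)$). Call $\mathcal T$ verifying if every symmetric ideal $X$ with $E(X\mid\mathcal T)\subseteq X$ is majorant, where $E(\cdot\mid\mathcal T)$ is the conditional expectation. **Theorem.** For every $n\ge1$ one has $\sum_{k>n}a_k=t_n$, and the conditions $$\sup_{n\ge 1}\frac{a_n}{\sum_{k>n}a_k}<\infty\qquad\text{and}\qquad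 \sup_{n\ge 1}\frac{t_{n-1}}{t_n}<\infty$$ are equivalent. If they hold, then $\mathcal T$ is verifying. If the sequence $(a_n)$ is non-increasing and $\mathcal T$ is verifying, then they hold. -/

import Mathlib

open MeasureTheory Set Filter Topology
open scoped ENNReal

namespace AveragingIdeals

noncomputable section

/-- The probability Lebesgue measure of the interval `I = (0, 1]`, as a measure on `ℝ`. -/
def lam : Measure ℝ := (volume : Measure ℝ).restrict (Ioc 0 1)

instance lam_isProbabilityMeasure : IsProbabilityMeasure lam :=
  ⟨by simp [lam]⟩

/-- The space `L¹(I)` of classes of a.e. equal integrable functions on `I`. -/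
abbrev L1 : Type := Lp ℝ 1 lam

/-- `f ∈ L¹(I)` belongs to `L^∞(I)`. -/
def IsEssBounded (f : L1) : Prop := MemLp (f : ℝ → ℝ) ∞ lam

/-- The non-increasing rearrangement `f*` of `|f|`: the right-continuous non-increasing function
on `I` that is equimeasurable with `|f|`. -/
def rearr (f : L1) (t : ℝ) : ℝ :=
  sInf {s : ℝ | 0 ≤ s ∧ lam {x | s < |(f : ℝ → ℝ) x|} ≤ ENNReal.ofReal t}

/-- A vector space `X` with `L^∞(I) ⊆ X ⊆ L¹(I)` that is an order ideal in `L¹(I)`. -/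
structure IsOrderIdeal (X : Submodule ℝ L1) : Prop where
  essBounded_mem : ∀ x : L1, IsEssBounded x → x ∈ X
  solid : ∀ x ∈ X, ∀ y : L1, |y| ≤ |x| → y ∈ X

/-- An ideal `X` is symmetric if `x ∈ X` and `y* ≤ x*` imply `y ∈ X`. -/
structure IsSymmetricIdeal (X : Submodule ℝ L1) : Prop extends IsOrderIdeal X where
  symm_mem : ∀ x ∈ X, ∀ y : L1, (∀ t ∈ Ioc (0 : ℝ) 1, rearr y t ≤ rearr x t) → y ∈ X

/-- A bounded linear operator on `L¹(I)` is admissible if it maps `L^∞(I)` into `L^∞(I)`. -/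
def IsAdmissible (T : L1 →L[ℝ] L1) : Prop :=
  ∀ x : L1, IsEssBounded x → IsEssBounded (T x)

/-- Interpolation spaces between `L¹(I)` and `L^∞(I)`: vector spaces `X` with
`L^∞(I) ⊆ X ⊆ L¹(I)` that every admissible operator maps into itself. -/
structure IsInterpolationSpace (X : Submodule ℝ L1) : Prop where
  essBounded_mem : ∀ x : L1, IsEssBounded x → x ∈ X
  map_mem : ∀ T : L1 →L[ℝ] L1, IsAdmissible T → ∀ x ∈ X, T x ∈ X

/-- A majorant ideal is an ideal that is an interpolation space. -/
def IsMajorantIdeal (X : Submodule ℝ L1) : Prop :=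
  IsOrderIdeal X ∧ IsInterpolationSpace X

/-- A `σ`-subalgebra: a sub-`σ`-algebra that contains all the sets of measure zero. (Measurable
sets are Borel here; modulo null sets these are the same as the Lebesgue measurable sets, so that
the spaces `L¹` and the averaging operators are the same.) -/
structure SigmaSubalgebra where
  toMeasurableSpace : MeasurableSpace ℝ
  le_borel : toMeasurableSpace ≤ Real.measurableSpace
  null_mem : ∀ N : Set ℝ, MeasurableSet[Real.measurableSpace] N → lam N = 0 →
    MeasurableSet[toMeasurableSpace] N

/-- The averaging operator (conditional expectation) `E(· | 𝒜)` on `L¹(I)`. -/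
def SigmaSubalgebra.average (A : SigmaSubalgebra) (f : L1) : L1 :=
  (integrable_condExp (m := A.toMeasurableSpace) (μ := lam) (f := (f : ℝ → ℝ))).toL1 _

/-- `𝒜` averages `X` if `E(X | 𝒜) ⊆ X`. -/
def SigmaSubalgebra.Averages (A : SigmaSubalgebra) (X : Submodule ℝ L1) : Prop :=
  ∀ x ∈ X, A.average x ∈ X

/-- `𝒜` is verifying if every symmetric ideal averaged by `𝒜` is majorant. -/
def SigmaSubalgebra.IsVerifying (A : SigmaSubalgebra) : Prop :=
  ∀ X : Submodule ℝ L1, IsSymmetricIdeal X → A.Averages X → IsMajorantIdeal X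

/-- The end points `1 = t₀ > t₁ > ⋯`, `tₙ → 0`, of an interval partition `(tₙ)`. -/
structure IntervalPartition where
  pt : ℕ → ℝ
  pt_zero : pt 0 = 1
  strictAnti : StrictAnti pt
  tendsto_zero : Tendsto pt atTop (𝓝 0)

namespace IntervalPartition

/-- The `n`-th atom, `n ≥ 0`, which is the interval `(tₙ₊₁, tₙ]`. -/
def atom (T : IntervalPartition) (n : ℕ) : Set ℝ := Ioc (T.pt (n + 1)) (T.pt n)

/-- The `σ`-subalgebra generated by the atoms (and the null sets). -/
def sigma (T : IntervalPartition) : SigmaSubalgebra where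
  toMeasurableSpace :=
    MeasurableSpace.generateFrom (range T.atom ∪ {N | MeasurableSet N ∧ lam N = 0})
  le_borel := by
    refine MeasurableSpace.generateFrom_le ?_
    rintro s (⟨n, rfl⟩ | ⟨hs, -⟩)
    · exact measurableSet_Ioc
    · exact hs
  null_mem N hN h0 := MeasurableSpace.measurableSet_generateFrom (Or.inr ⟨hN, h0⟩)

/-- The stochastic vector of the partition, i.e. the lengths of the atoms; indexed from `0`. -/
def stochasticVector (T : IntervalPartition) (n : ℕ) : ℝ := T.pt n - T.pt (n + 1)

/-- The partition is verifying if the `σ`-subalgebra it generates is. -/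
def IsVerifying (T : IntervalPartition) : Prop := T.sigma.IsVerifying

/-- The partition is monotonic if its stochastic vector is non-increasing. -/
def IsMonotonic (T : IntervalPartition) : Prop :=
  ∀ n, T.stochasticVector (n + 1) ≤ T.stochasticVector n

end IntervalPartition

end

end AveragingIdeals

namespace AveragingIdeals

noncomputable section

/-! ### The distribution function and the rearrangement -/

/-! Write `F(t) = ∫₀ᵗ x*` and `G(t) = ∫₀ᵗ y*`, which are K-functionals for the couple `(L¹, L^∞)`.

Sufficiency. An admissible operator `S` is also bounded on `L^∞`, so cutting `x` at height `x*(t)`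
shows that `y = S x` satisfies `G ≤ C F` (`IsAdmissible.exists_rearrIntegral_le`). It remains to see
that an averaged symmetric `X` is closed under this relation (`mem_of_rearrIntegral_le`). Take a
monotone `r(u) ≤ u` with `C F(r(u)) = G(u)`. For an atom of length `a` and left end `b`, the piece
of `x*` over `(r(b/2), r(b)]` carries mass at least `b y*(b) / 2C`. Compressed by the factor
`2Bb/a`, it fits into the atom and has mean at least `y*(b) / 4BC` there. The pieces of two atoms
overlap only if their left ends are within a factor two of each other, and then `tₙ ≤ B tₙ₊₁` bounds
the total weight of the overlap by one (`tsum_weight_le_one`). So the assembled function has a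
rearrangement below `x*`, hence lies in `X`, and a multiple of its average dominates `y*`.

Necessity. If the ratios are unbounded, there are atoms of length `α i` whose left ends `τ i` are
far smaller. Let `X` consist of the functions of size `O(1/α i)` off a set of measure `O(τ i)`,
uniformly in `i`. Since the lengths are non-increasing, averaging puts all of `L¹` into `X`
(`averages_gapIdeal`). But `X` is not majorant (`not_isMajorantIdeal_gapIdeal`): a different
partition, with points strictly between the scales `τ i` and `α i`, spreads suitable peaks in `X`
over sets too large for `X`, and its averaging operator is admissible. -/

lemma lam_apply {A : Set ℝ} (hA : MeasurableSet A) : lam A = volume (A ∩ Ioc 0 1) :=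
  Measure.restrict_apply hA

lemma lam_distr_congr {f g : ℝ → ℝ} (h : f =ᵐ[lam] g) (s : ℝ) :
    lam {x | s < |f x|} = lam {x | s < |g x|} := by
  refine measure_congr ?_
  filter_upwards [h] with x hx
  change (s < |f x|) = (s < |g x|)
  rw [hx]

lemma lam_distr_antitone (f : ℝ → ℝ) : Antitone fun s : ℝ => lam {x | s < |f x|} :=
  fun _ _ h => measure_mono fun _ hx => lt_of_le_of_lt h hx

lemma lam_distr_le_of_forall_gt {f : ℝ → ℝ} {s : ℝ} {c : ℝ≥0∞}
    (h : ∀ u, s < u → lam {x | u < |f x|} ≤ c) : lam {x | s < |f x|} ≤ c := by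
  have hmono : Monotone fun n : ℕ => {x | s + 1 / ((n : ℝ) + 1) < |f x|} := by
    intro m n hmn x hx
    have h1 := Nat.one_div_le_one_div (α := ℝ) hmn
    have h2 : s + 1 / ((m : ℝ) + 1) < |f x| := hx
    change s + 1 / ((n : ℝ) + 1) < |f x|
    linarith
  have hU : {x | s < |f x|} = ⋃ n : ℕ, {x | s + 1 / ((n : ℝ) + 1) < |f x|} := by
    ext x
    simp only [mem_ofPred_eq, mem_iUnion]
    constructor
    · intro hx
      obtain ⟨n, hn⟩ := exists_nat_one_div_lt (sub_pos.2 hx)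
      exact ⟨n, by linarith⟩
    · rintro ⟨n, hn⟩
      have : (0 : ℝ) < 1 / ((n : ℝ) + 1) := by positivity
      linarith
  rw [hU, hmono.measure_iUnion]
  exact iSup_le fun n => h _ (by have : (0 : ℝ) < 1 / ((n : ℝ) + 1) := by positivity
                                 linarith)

lemma L1.integrable (f : L1) : Integrable (f : ℝ → ℝ) lam := L1.integrable_coeFn f

lemma exists_lam_distr_le {f : ℝ → ℝ} (hf : Integrable f lam) {t : ℝ} (ht : 0 < t) :
    ∃ s, 0 ≤ s ∧ lam {x | s < |f x|} ≤ ENNReal.ofReal t := by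
  set M : ℝ := ∫ x, |f x| ∂lam
  have hM : 0 ≤ M := integral_nonneg fun _ => abs_nonneg _
  refine ⟨(M + 1) / t, by positivity, ?_⟩
  have hpos : 0 < (M + 1) / t := by positivity
  have h1 := mul_meas_ge_le_integral_of_nonneg (μ := lam) (f := fun x => |f x|)
    (Eventually.of_forall fun _ => abs_nonneg _) hf.abs ((M + 1) / t)
  have h2 : lam.real {x | (M + 1) / t ≤ |f x|} ≤ t := by
    rw [div_mul_eq_mul_div, div_le_iff₀ ht] at h1
    have h3 : (M + 1) * lam.real {x | (M + 1) / t ≤ |f x|} ≤ (M + 1) * t := by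
      nlinarith
    exact le_of_mul_le_mul_left h3 (by positivity)
  calc lam {x | (M + 1) / t < |f x|} ≤ lam {x | (M + 1) / t ≤ |f x|} :=
        measure_mono fun x (hx : (M + 1) / t < |f x|) => (le_of_lt hx : (M + 1) / t ≤ |f x|)
    _ = ENNReal.ofReal (lam.real {x | (M + 1) / t ≤ |f x|}) := by
        rw [ofReal_measureReal]
    _ ≤ _ := ENNReal.ofReal_le_ofReal h2

lemma rearr_nonneg (f : L1) (t : ℝ) : 0 ≤ rearr f t := Real.sInf_nonneg fun _ h => h.1

/-- The distribution function is right-continuous in the level, so the infimum defining the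
rearrangement is attained. Positivity of `t` makes the set of levels non-empty, by Markov's
inequality. -/
lemma rearr_le_iff (f : L1) {s t : ℝ} (hs : 0 ≤ s) (ht : 0 < t) :
    rearr f t ≤ s ↔ lam {x | s < |(f : ℝ → ℝ) x|} ≤ ENNReal.ofReal t := by
  have hbdd : BddBelow {s : ℝ | 0 ≤ s ∧ lam {x | s < |(f : ℝ → ℝ) x|} ≤ ENNReal.ofReal t} :=
    ⟨0, fun _ h => h.1⟩
  constructor
  · intro h
    refine lam_distr_le_of_forall_gt fun u hu => ?_
    obtain ⟨v, hv, hvu⟩ := exists_lt_of_csInf_lt (exists_lam_distr_le (L1.integrable f) ht)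
      (lt_of_le_of_lt h hu)
    exact (lam_distr_antitone _ hvu.le).trans hv.2
  · exact fun h => csInf_le hbdd ⟨hs, h⟩

lemma lt_rearr_iff (f : L1) {s t : ℝ} (hs : 0 ≤ s) (ht : 0 < t) :
    s < rearr f t ↔ ENNReal.ofReal t < lam {x | s < |(f : ℝ → ℝ) x|} := by
  rw [← not_le, ← not_le, rearr_le_iff f hs ht]

lemma rearr_antitoneOn (f : L1) : AntitoneOn (rearr f) (Ioi 0) := by
  intro t ht u hu htu
  rw [rearr_le_iff f (rearr_nonneg _ _) hu]
  exact ((rearr_le_iff f (rearr_nonneg _ _) ht).1 le_rfl).trans (ENNReal.ofReal_le_ofReal htu)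

lemma ae_lam_mem : ∀ᵐ x ∂lam, x ∈ Ioc (0 : ℝ) 1 := ae_restrict_mem measurableSet_Ioc

/-- The rearrangement, extended by zero outside of `(0, 1]`. -/
def rearrFun (f : L1) : ℝ → ℝ := (Ioc (0 : ℝ) 1).indicator (rearr f)

lemma rearrFun_of_mem (f : L1) {t : ℝ} (ht : t ∈ Ioc (0 : ℝ) 1) : rearrFun f t = rearr f t :=
  indicator_of_mem ht _

lemma rearrFun_nonneg (f : L1) (t : ℝ) : 0 ≤ rearrFun f t :=
  indicator_nonneg (fun _ _ => rearr_nonneg f _) _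

lemma rearrFun_antitoneOn (f : L1) : AntitoneOn (rearrFun f) (Ioi 0) := by
  intro t ht u hu htu
  by_cases h : u ≤ 1
  · rw [rearrFun_of_mem f ⟨ht, htu.trans h⟩, rearrFun_of_mem f ⟨hu, h⟩]
    exact rearr_antitoneOn f ht hu htu
  · rw [rearrFun, indicator_of_notMem (fun h' : u ∈ Ioc (0 : ℝ) 1 => h h'.2)]
    exact rearrFun_nonneg f t

lemma setOf_lt_rearrFun (f : L1) {s : ℝ} (hs : 0 ≤ s) :
    {t | s < rearrFun f t} =
      Ioo 0 (lam.real {x | s < |(f : ℝ → ℝ) x|}) ∩ Ioc 0 1 := by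
  ext t
  by_cases ht : t ∈ Ioc (0 : ℝ) 1
  · simp only [mem_ofPred_eq, mem_inter_iff, ht, and_true, rearrFun_of_mem f ht,
      lt_rearr_iff f hs ht.1, mem_Ioo, ht.1, true_and]
    rw [ENNReal.ofReal_lt_iff_lt_toReal ht.1.le (measure_ne_top _ _)]
    rfl
  · simp [rearrFun, ht, hs]

lemma measurable_rearrFun (f : L1) : Measurable (rearrFun f) := by
  refine measurable_of_Ioi fun s => ?_
  change MeasurableSet {t | s < rearrFun f t}
  by_cases hs : 0 ≤ s
  · rw [setOf_lt_rearrFun f hs]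
    exact measurableSet_Ioo.inter measurableSet_Ioc
  · convert MeasurableSet.univ
    rw [eq_univ_iff_forall]
    exact fun t => (not_le.1 hs).trans_le (rearrFun_nonneg f t)

/-- Equimeasurability: the superlevel set of the rearrangement is an interval starting at `0` whose
length is the value of the distribution function. -/
lemma lam_lt_rearrFun (f : L1) {s : ℝ} (hs : 0 ≤ s) :
    lam {t | s < rearrFun f t} = lam {x | s < |(f : ℝ → ℝ) x|} := by
  rw [setOf_lt_rearrFun f hs, lam_apply (measurableSet_Ioo.inter measurableSet_Ioc), inter_assoc,
    inter_self]
  set m := lam.real {x | s < |(f : ℝ → ℝ) x|} with hm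
  have hm1 : m ≤ 1 := measureReal_le_one
  have h : Ioo 0 m ∩ Ioc 0 1 = Ioo 0 m := by
    rw [inter_eq_left]
    exact fun t ht => ⟨ht.1, ht.2.le.trans hm1⟩
  rw [h, Real.volume_Ioo, sub_zero, hm, ofReal_measureReal]

lemma lam_distr_rearrFun (f : L1) {s : ℝ} (hs : 0 ≤ s) :
    lam {t | s < |rearrFun f t|} = lam {x | s < |(f : ℝ → ℝ) x|} := by
  simp only [abs_of_nonneg (rearrFun_nonneg f _)]
  exact lam_lt_rearrFun f hs

/-- Domination of distribution functions implies domination of the truncated integrals. -/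
lemma lintegral_sub_le_of_distr_le {f g : ℝ → ℝ} (hf : AEMeasurable f lam)
    (hg : AEMeasurable g lam)
    (h : ∀ s, 0 ≤ s → lam {x | s < |f x|} ≤ lam {x | s < |g x|}) {s : ℝ} (hs : 0 ≤ s) :
    ∫⁻ x, ENNReal.ofReal (|f x| - s) ∂lam ≤ ∫⁻ x, ENNReal.ofReal (|g x| - s) ∂lam := by
  have key : ∀ {k : ℝ → ℝ}, AEMeasurable k lam →
      ∫⁻ x, ENNReal.ofReal (|k x| - s) ∂lam =
        ∫⁻ u in Ioi (0 : ℝ), lam {x | u + s < |k x|} := by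
    intro k hk
    -- Layer-cake formula for the part of `|k|` above the level `s`.
    have h1 := lintegral_eq_lintegral_meas_lt lam (f := fun x => max (|k x| - s) 0)
      (Eventually.of_forall fun _ => le_max_right _ _)
      (((measurable_id.abs.comp_aemeasurable hk).sub_const s).max aemeasurable_const)
    have h2 : ∀ x, ENNReal.ofReal (max (|k x| - s) 0) = ENNReal.ofReal (|k x| - s) := by
      intro x
      rw [ENNReal.ofReal_max, ENNReal.ofReal_zero, max_eq_left zero_le]
    simp only [h2] at h1
    rw [h1]
    refine setLIntegral_congr_fun measurableSet_Ioi fun u hu => ?_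
    congr 1
    ext x
    have hu' : (0 : ℝ) < u := hu
    simp only [mem_ofPred_eq, lt_max_iff, not_lt.2 hu'.le, or_false, lt_sub_iff_add_lt]
  rw [key hf, key hg]
  exact setLIntegral_mono' measurableSet_Ioi fun u hu =>
    h _ (add_nonneg (le_of_lt hu) hs)

lemma integrable_of_distr_le {f g : ℝ → ℝ} (hf : AEMeasurable f lam) (hg : Integrable g lam)
    (h : ∀ s, 0 ≤ s → lam {x | s < |f x|} ≤ lam {x | s < |g x|}) : Integrable f lam := by
  refine ⟨hf.aestronglyMeasurable, ?_⟩
  have h1 := lintegral_sub_le_of_distr_le hf hg.aemeasurable h le_rfl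
  simp only [sub_zero] at h1
  rw [hasFiniteIntegral_iff_norm]
  refine h1.trans_lt ?_
  have := hg.2
  rwa [hasFiniteIntegral_iff_norm] at this

lemma integrable_rearrFun (f : L1) : Integrable (rearrFun f) lam :=
  integrable_of_distr_le (measurable_rearrFun f).aemeasurable (L1.integrable f)
    fun _ hs => (lam_distr_rearrFun f hs).le

lemma integral_truncation_le_of_distr_le {f g : ℝ → ℝ} (hf : Integrable f lam)
    (hg : Integrable g lam)
    (h : ∀ s, 0 ≤ s → lam {x | s < |f x|} ≤ lam {x | s < |g x|}) {s : ℝ} (hs : 0 ≤ s) :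
    ∫ x, max (|f x| - s) 0 ∂lam ≤ ∫ x, max (|g x| - s) 0 ∂lam := by
  have hint : ∀ {k : ℝ → ℝ}, Integrable k lam → Integrable (fun x => max (|k x| - s) 0) lam :=
    fun hk => (hk.abs.sub (integrable_const s)).pos_part
  have key : ∀ {k : ℝ → ℝ}, Integrable k lam → ∫ x, max (|k x| - s) 0 ∂lam =
      (∫⁻ x, ENNReal.ofReal (|k x| - s) ∂lam).toReal := by
    intro k hk
    rw [integral_eq_lintegral_of_nonneg_ae (f := fun x => max (|k x| - s) 0)
      (Eventually.of_forall fun _ => le_max_right _ _)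
      (hint hk).aestronglyMeasurable]
    simp only [ENNReal.ofReal_max, ENNReal.ofReal_zero]
    congr 2
    ext x
    exact max_eq_left zero_le
  rw [key hf, key hg]
  refine ENNReal.toReal_mono ?_ (lintegral_sub_le_of_distr_le hf.aemeasurable hg.aemeasurable h hs)
  have := (hint hg).lintegral_lt_top
  simp only [ENNReal.ofReal_max, ENNReal.ofReal_zero] at this
  refine ne_of_lt (lt_of_le_of_lt (lintegral_mono fun x => ?_) this)
  exact le_max_left _ _

/-! ### Symmetric ideals -/

lemma rearr_le_of_distr_le {x y : L1}
    (h : ∀ s, 0 ≤ s → lam {t | s < |(y : ℝ → ℝ) t|} ≤ lam {t | s < |(x : ℝ → ℝ) t|})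
    {t : ℝ} (ht : 0 < t) : rearr y t ≤ rearr x t := by
  rw [rearr_le_iff y (rearr_nonneg _ _) ht]
  exact (h _ (rearr_nonneg _ _)).trans ((rearr_le_iff x (rearr_nonneg _ _) ht).1 le_rfl)

lemma distr_le_of_rearr_le {x y : L1}
    (h : ∀ t ∈ Ioc (0 : ℝ) 1, rearr y t ≤ rearr x t) {s : ℝ} (hs : 0 ≤ s) :
    lam {t | s < |(y : ℝ → ℝ) t|} ≤ lam {t | s < |(x : ℝ → ℝ) t|} := by
  rw [← lam_lt_rearrFun y hs, ← lam_lt_rearrFun x hs]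
  refine measure_mono fun t ht => ?_
  by_cases h1 : t ∈ Ioc (0 : ℝ) 1
  · simp only [mem_ofPred_eq, rearrFun_of_mem _ h1] at ht ⊢
    exact ht.trans_le (h t h1)
  · simp [rearrFun, h1, not_lt.2 hs] at ht

lemma IsSymmetricIdeal.mem_of_distr_le {X : Submodule ℝ L1} (hX : IsSymmetricIdeal X) {x y : L1}
    (hx : x ∈ X)
    (h : ∀ s, 0 ≤ s → lam {t | s < |(y : ℝ → ℝ) t|} ≤ lam {t | s < |(x : ℝ → ℝ) t|}) : y ∈ X :=
  hX.symm_mem x hx y fun _ ht => rearr_le_of_distr_le h ht.1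

lemma abs_le_abs_of_ae {x y : L1} (h : ∀ᵐ t ∂lam, |(y : ℝ → ℝ) t| ≤ |(x : ℝ → ℝ) t|) :
    |y| ≤ |x| := by
  rw [← Lp.coeFn_le]
  filter_upwards [h, Lp.coeFn_abs x, Lp.coeFn_abs y] with t h1 h2 h3
  rwa [h2, h3]

lemma ae_of_abs_le_abs {x y : L1} (h : |y| ≤ |x|) :
    ∀ᵐ t ∂lam, |(y : ℝ → ℝ) t| ≤ |(x : ℝ → ℝ) t| := by
  filter_upwards [(Lp.coeFn_le _ _).2 h, Lp.coeFn_abs x, Lp.coeFn_abs y] with t h1 h2 h3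
  rwa [h2, h3] at h1

/-- Essential boundedness is the existence of an almost everywhere bound. -/
lemma isEssBounded_iff (f : L1) :
    IsEssBounded f ↔ ∃ c, ∀ᵐ x ∂lam, |(f : ℝ → ℝ) x| ≤ c := by
  constructor
  · intro h
    refine ⟨(eLpNormEssSup (f : ℝ → ℝ) lam).toReal, ?_⟩
    have hlt : eLpNormEssSup (f : ℝ → ℝ) lam < ∞ := by simpa using h.2
    filter_upwards [ae_le_eLpNormEssSup (f := (f : ℝ → ℝ)) (μ := lam)] with x hx
    rw [← Real.norm_eq_abs, ← toReal_enorm]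
    exact ENNReal.toReal_mono hlt.ne hx
  · rintro ⟨c, hc⟩
    exact memLp_top_of_bound (Lp.aestronglyMeasurable f) c hc

/-! ### Interval partitions -/

namespace IntervalPartition

variable (T : IntervalPartition)

lemma pt_pos (n : ℕ) : 0 < T.pt n :=
  (T.strictAnti.antitone.le_of_tendsto T.tendsto_zero (n + 1)).trans_lt (T.strictAnti n.lt_succ_self)

lemma pt_le_one (n : ℕ) : T.pt n ≤ 1 := T.pt_zero ▸ T.strictAnti.antitone n.zero_le

lemma pt_succ_lt (n : ℕ) : T.pt (n + 1) < T.pt n := T.strictAnti n.lt_succ_self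

lemma stochasticVector_pos (n : ℕ) : 0 < T.stochasticVector n := sub_pos.2 (T.pt_succ_lt n)

lemma atom_subset_Ioc (n : ℕ) : T.atom n ⊆ Ioc 0 1 := fun _ hx =>
  ⟨(T.pt_pos _).trans hx.1, hx.2.trans (T.pt_le_one n)⟩

lemma measurableSet_atom (n : ℕ) : MeasurableSet (T.atom n) := measurableSet_Ioc

lemma lam_restrict_atom (n : ℕ) : lam.restrict (T.atom n) = volume.restrict (T.atom n) := by
  rw [lam, Measure.restrict_restrict (T.measurableSet_atom n),
    inter_eq_left.2 (T.atom_subset_Ioc n)]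

lemma lam_atom (n : ℕ) : lam (T.atom n) = ENNReal.ofReal (T.stochasticVector n) := by
  rw [lam, Measure.restrict_apply (T.measurableSet_atom n),
    inter_eq_left.2 (T.atom_subset_Ioc n), atom, Real.volume_Ioc, stochasticVector]

lemma lam_real_atom (n : ℕ) : lam.real (T.atom n) = T.stochasticVector n := by
  rw [Measure.real, lam_atom, ENNReal.toReal_ofReal (T.stochasticVector_pos n).le]

lemma iUnion_atom : ⋃ n, T.atom n = Ioc 0 1 := by
  refine subset_antisymm (iUnion_subset T.atom_subset_Ioc) fun x hx => ?_
  have hex : ∃ n, T.pt n < x := (T.tendsto_zero.eventually (gt_mem_nhds hx.1)).exists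
  have h0 : Nat.find hex ≠ 0 := by
    intro h
    have := Nat.find_spec hex
    rw [h, T.pt_zero] at this
    exact absurd hx.2 (not_le.2 this)
  obtain ⟨k, hk⟩ := Nat.exists_eq_succ_of_ne_zero h0
  refine mem_iUnion.2 ⟨k, ?_, ?_⟩
  · have := Nat.find_spec hex
    rwa [hk] at this
  · exact not_lt.1 (Nat.find_min hex (by rw [hk]; exact k.lt_succ_self))

lemma pairwise_disjoint_atom : Pairwise (Function.onFun Disjoint T.atom) :=
  T.strictAnti.antitone.pairwise_disjoint_on_Ioc_succ

lemma ae_exists_mem_atom : ∀ᵐ x ∂lam, ∃ n, x ∈ T.atom n := by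
  filter_upwards [ae_lam_mem] with x hx
  rwa [← T.iUnion_atom, mem_iUnion] at hx

/-- Measurable functions can be prescribed on each atom. -/
lemma exists_measurable_eqOn_atom (f : ℕ → ℝ → ℝ) (hf : ∀ n, Measurable (f n)) :
    ∃ g : ℝ → ℝ, Measurable g ∧ ∀ n, EqOn g (f n) (T.atom n) := by
  refine exists_measurable_piecewise T.atom T.measurableSet_atom f hf fun i j hij x hx => ?_
  exact absurd hx (disjoint_left.1 (T.pairwise_disjoint_atom hij) hx.1 ∘ fun h => h.2)

lemma lam_iUnion_inter_atom (A : Set ℝ) (hA : MeasurableSet A) :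
    lam A = ∑' n, lam (A ∩ T.atom n) := by
  rw [← measure_iUnion (fun i j hij => (T.pairwise_disjoint_atom hij).mono
    inter_subset_right inter_subset_right) fun n => hA.inter (T.measurableSet_atom n),
    ← inter_iUnion, T.iUnion_atom]
  refine measure_congr ?_
  filter_upwards [ae_lam_mem] with x hx
  exact propext ⟨fun h => ⟨h, hx⟩, fun h => h.1⟩

lemma sum_stochasticVector (n : ℕ) :
    HasSum (fun k => T.stochasticVector (n + k)) (T.pt n) := by
  rw [hasSum_iff_tendsto_nat_of_nonneg fun k => (T.stochasticVector_pos _).le]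
  have h : ∀ m, ∑ k ∈ Finset.range m, T.stochasticVector (n + k) = T.pt n - T.pt (n + m) := by
    intro m
    have := Finset.sum_range_sub' (fun k => T.pt (n + k)) m
    simpa [stochasticVector, add_assoc] using this
  simp only [h]
  have h2 : Tendsto (fun m => T.pt (n + m)) atTop (𝓝 0) :=
    T.tendsto_zero.comp (tendsto_add_atTop_nat n |>.congr fun m => add_comm m n)
  simpa using tendsto_const_nhds.sub h2

/-! ### The averaging operator of an interval partition -/

/-- Modulo null sets the intervals are atoms of the generated `σ`-algebra; the dichotomy passes
through complements and countable unions. -/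
lemma atom_inter_or (s : Set ℝ) (hs : MeasurableSet[T.sigma.toMeasurableSpace] s) (n : ℕ) :
    lam (T.atom n ∩ s) = 0 ∨ lam (T.atom n \ s) = 0 := by
  induction s, hs using MeasurableSpace.generateFrom_induction with
  | hC t ht _ =>
    rcases ht with ⟨m, rfl⟩ | ⟨-, h0⟩
    · by_cases h : n = m
      · right; rw [h, sdiff_self, measure_empty]
      · left; rw [(T.pairwise_disjoint_atom h).inter_eq, measure_empty]
    · exact Or.inl (measure_mono_null inter_subset_right h0)
  | empty => left; simp
  | compl t _ ih =>
    rw [sdiff_compl, ← sdiff_eq]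
    exact ih.symm
  | iUnion t _ ih =>
    by_cases h : ∀ i, lam (T.atom n ∩ t i) = 0
    · left
      rw [inter_iUnion]
      exact measure_iUnion_null h
    · push Not at h
      obtain ⟨i, hi⟩ := h
      right
      exact measure_mono_null (sdiff_subset_sdiff_right (subset_iUnion t i)) ((ih i).resolve_left hi)

lemma condExp_ae_eq {f g : ℝ → ℝ} (hf : Integrable f lam) (hg : Integrable g lam) {c : ℕ → ℝ}
    (hgc : ∀ n, EqOn g (fun _ => c n) (T.atom n))
    (hc : ∀ n, T.stochasticVector n * c n = ∫ x in T.atom n, f x ∂lam) :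
    g =ᵐ[lam] lam[f | T.sigma.toMeasurableSpace] := by
  have hatom : ∀ n, MeasurableSet[T.sigma.toMeasurableSpace] (T.atom n) := fun n =>
    MeasurableSpace.measurableSet_generateFrom (Or.inl ⟨n, rfl⟩)
  refine ae_eq_condExp_of_forall_setIntegral_eq T.sigma.le_borel hf
    (fun s _ _ => hg.integrableOn) (fun s hs _ => ?_) ?_
  · have hs' : MeasurableSet s := T.sigma.le_borel _ hs
    have key : ∀ k : ℝ → ℝ, Integrable k lam →
        HasSum (fun n => ∫ x in T.atom n ∩ s, k x ∂lam) (∫ x in s, k x ∂lam) := by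
      intro k hk
      have h1 := hasSum_integral_iUnion (μ := lam) (f := k) (s := fun n => T.atom n ∩ s)
        (fun n => (T.measurableSet_atom n).inter hs')
        (fun i j hij => (T.pairwise_disjoint_atom hij).mono inter_subset_left inter_subset_left)
        hk.integrableOn
      rw [← iUnion_inter, T.iUnion_atom] at h1
      have hae : (Ioc 0 1 ∩ s : Set ℝ) =ᵐ[lam] s := by
        filter_upwards [ae_lam_mem] with x hx
        exact propext ⟨fun h => h.2, fun h => ⟨hx, h⟩⟩
      rwa [setIntegral_congr_set hae] at h1
    refine (key g hg).unique ?_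
    convert key f hf using 2 with n
    rcases T.atom_inter_or s hs n with h0 | h0
    · rw [setIntegral_measure_zero _ h0, setIntegral_measure_zero _ h0]
    · have hae : (T.atom n ∩ s : Set ℝ) =ᵐ[lam] T.atom n := by
        rw [← sdiff_self_inter] at h0
        exact inter_subset_left.eventuallyLE.antisymm (ae_le_set.2 h0)
      rw [setIntegral_congr_set hae, setIntegral_congr_set hae, ← hc,
        setIntegral_congr_fun (T.measurableSet_atom n) (hgc n), setIntegral_const,
        T.lam_real_atom, smul_eq_mul]
  -- Outside the atoms `g` is arbitrary, so it need not be measurable for the small `σ`-algebra; an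
  -- a.e. equal version is.
  · obtain ⟨g', hg', hg'c⟩ := @exists_measurable_piecewise ℝ ℝ T.sigma.toMeasurableSpace _ ℕ _ _
      T.atom hatom (fun n _ => c n) (fun n => @measurable_const _ _ _ _ _) fun i j hij x hx =>
        absurd hx (disjoint_left.1 (T.pairwise_disjoint_atom hij) hx.1 ∘ fun h => h.2)
    refine ⟨g', @Measurable.stronglyMeasurable _ _ _ T.sigma.toMeasurableSpace _ _ _ _ _ hg', ?_⟩
    filter_upwards [T.ae_exists_mem_atom] with x ⟨n, hn⟩
    rw [hgc n hn, hg'c n hn]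

/-- The averaging operator replaces a function by its mean values on the atoms. -/
lemma average_ae_eq (f : L1) : ∀ᵐ x ∂lam, ∀ n, x ∈ T.atom n →
    (T.sigma.average f : ℝ → ℝ) x =
      (∫ u in T.atom n, (f : ℝ → ℝ) u ∂lam) / T.stochasticVector n := by
  set c : ℕ → ℝ := fun n => (∫ u in T.atom n, (f : ℝ → ℝ) u ∂lam) / T.stochasticVector n with hcdef
  have hc : ∀ n, T.stochasticVector n * c n = ∫ u in T.atom n, (f : ℝ → ℝ) u ∂lam := fun n =>
    mul_div_cancel₀ _ (T.stochasticVector_pos n).ne'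
  obtain ⟨g, hg, hgc⟩ := T.exists_measurable_eqOn_atom (fun n _ => c n) fun _ => measurable_const
  have hf := L1.integrable f
  have hgi : Integrable g lam := by
    have hint : IntegrableOn g (⋃ n, T.atom n) lam := by
      refine integrableOn_iUnion_of_summable_integral_norm (fun n => ?_) ?_
      · exact (integrableOn_const (C := c n) (by simp)).congr_fun (hgc n).symm (T.measurableSet_atom n)
      · have h1 : Summable fun n => ∫ u in T.atom n, |(f : ℝ → ℝ) u| ∂lam :=
          (hasSum_integral_iUnion T.measurableSet_atom T.pairwise_disjoint_atom
            hf.abs.integrableOn).summable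
        refine h1.of_nonneg_of_le (fun n => integral_nonneg fun _ => norm_nonneg _) fun n => ?_
        have h2 : EqOn (fun x => ‖g x‖) (fun _ => ‖c n‖) (T.atom n) := fun x hx => by
          simp only [hgc n hx]
        rw [setIntegral_congr_fun (T.measurableSet_atom n) h2, setIntegral_const,
          T.lam_real_atom, smul_eq_mul, ← abs_of_pos (T.stochasticVector_pos n),
          Real.norm_eq_abs, ← abs_mul, hc]
        exact abs_integral_le_integral_abs
    rw [T.iUnion_atom] at hint
    have : lam.restrict (Ioc 0 1) = lam := by
      rw [lam, Measure.restrict_restrict measurableSet_Ioc, inter_self]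
    rwa [IntegrableOn, this] at hint
  have h1 := T.condExp_ae_eq hf hgi hgc hc
  have h2 : (T.sigma.average f : ℝ → ℝ) =ᵐ[lam] lam[(f : ℝ → ℝ) | T.sigma.toMeasurableSpace] :=
    Integrable.coeFn_toL1 _
  filter_upwards [h1, h2] with x hx1 hx2 n hn
  rw [hx2, ← hx1, hgc n hn]

end IntervalPartition

/-! ### Admissible operators and the K-functional -/

lemma memLp_one_of_linfty (f : Lp ℝ ∞ lam) : MemLp (f : ℝ → ℝ) 1 lam :=
  (Lp.memLp f).mono_exponent le_top

/-- The inclusion of `L^∞(I)` in `L¹(I)`. -/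
def linftyInclusion : Lp ℝ ∞ lam →L[ℝ] L1 :=
  LinearMap.mkContinuous
    { toFun := fun f => (memLp_one_of_linfty f).toLp _
      map_add' := fun f g => by
        rw [← MemLp.toLp_add]
        exact MemLp.toLp_congr _ _ (Lp.coeFn_add f g)
      map_smul' := fun c f => by
        rw [RingHom.id_apply, ← MemLp.toLp_const_smul]
        exact MemLp.toLp_congr _ _ (Lp.coeFn_smul c f) }
    1 fun f => by
      rw [one_mul]
      change ‖(memLp_one_of_linfty f).toLp _‖ ≤ _
      rw [Lp.norm_toLp, Lp.norm_def]
      exact ENNReal.toReal_mono (Lp.eLpNorm_ne_top f)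
        (eLpNorm_le_eLpNorm_of_exponent_le le_top (Lp.aestronglyMeasurable f))

lemma coeFn_linftyInclusion (f : Lp ℝ ∞ lam) : (linftyInclusion f : ℝ → ℝ) =ᵐ[lam] f :=
  MemLp.coeFn_toLp (memLp_one_of_linfty f)

lemma linftyInclusion_injective : Function.Injective linftyInclusion := fun f g h => by
  refine Lp.ext ((coeFn_linftyInclusion f).symm.trans ?_)
  rw [h]
  exact coeFn_linftyInclusion g

lemma isEssBounded_linftyInclusion (f : Lp ℝ ∞ lam) : IsEssBounded (linftyInclusion f) :=
  (memLp_congr_ae (coeFn_linftyInclusion f)).2 (Lp.memLp f)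

lemma linftyInclusion_toLp {f : L1} (hf : IsEssBounded f) :
    linftyInclusion (MemLp.toLp _ hf) = f :=
  Lp.ext ((coeFn_linftyInclusion _).trans (MemLp.coeFn_toLp _))

/-- An admissible operator is bounded for the supremum norm, by the closed graph theorem. -/
lemma IsAdmissible.exists_bound {T : L1 →L[ℝ] L1} (hT : IsAdmissible T) :
    ∃ M : ℝ, 0 ≤ M ∧ ∀ (f : L1) (s : ℝ), 0 ≤ s → (∀ᵐ x ∂lam, |(f : ℝ → ℝ) x| ≤ s) →
      ∀ᵐ x ∂lam, |(T f : ℝ → ℝ) x| ≤ M * s := by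
  have hB : ∀ f, IsEssBounded (T (linftyInclusion f)) := fun f =>
    hT _ (isEssBounded_linftyInclusion f)
  have hS : ∀ f, linftyInclusion (MemLp.toLp _ (hB f)) = T (linftyInclusion f) := fun f =>
    linftyInclusion_toLp (hB f)
  let S : Lp ℝ ∞ lam →ₗ[ℝ] Lp ℝ ∞ lam :=
    { toFun := fun f => MemLp.toLp _ (hB f)
      map_add' := fun f g => linftyInclusion_injective (by
        rw [hS, map_add, map_add, map_add, hS, hS])
      map_smul' := fun c f => linftyInclusion_injective (by
        rw [hS, map_smul, map_smul, map_smul, hS, RingHom.id_apply]) }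
  have hS' : ∀ f, linftyInclusion (S f) = T (linftyInclusion f) := hS
  have hcont : Continuous S := by
    -- Limits in `L^∞` are also limits in `L¹`, where `T` is continuous and limits are unique.
    refine S.continuous_of_seq_closed_graph fun u x y hu hy => linftyInclusion_injective ?_
    have h1 := (linftyInclusion.continuous.tendsto y).comp hy
    have h2 := ((T.continuous.comp linftyInclusion.continuous).tendsto x).comp hu
    refine tendsto_nhds_unique h1 ?_
    rw [hS']
    exact h2.congr fun n => (hS' _).symm
  let S' : Lp ℝ ∞ lam →L[ℝ] Lp ℝ ∞ lam := ⟨S, hcont⟩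
  refine ⟨‖S'‖, norm_nonneg _, fun f s hs hf => ?_⟩
  have hfb : IsEssBounded f := (isEssBounded_iff f).2 ⟨s, hf⟩
  set φ : Lp ℝ ∞ lam := MemLp.toLp _ hfb with hφ
  have hφf : linftyInclusion φ = f := linftyInclusion_toLp hfb
  have hn : ‖φ‖ ≤ s := (Lp.norm_le_of_ae_bound (f := φ) hs (by
    filter_upwards [hf, MemLp.coeFn_toLp hfb] with x h1 h2
    rwa [hφ, h2, Real.norm_eq_abs])).trans (by simp)
  have h1 : ‖S' φ‖ ≤ ‖S'‖ * s := (S'.le_opNorm φ).trans (by gcongr)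
  have h2 : ∀ᵐ x ∂lam, ‖(S' φ : ℝ → ℝ) x‖ ≤ ‖S' φ‖ := by
    filter_upwards [ae_le_eLpNormEssSup (f := (S' φ : ℝ → ℝ)) (μ := lam)] with x hx
    rw [Lp.norm_def, eLpNorm_exponent_top, ← toReal_enorm]
    refine ENNReal.toReal_mono ?_ hx
    have := Lp.eLpNorm_ne_top (S' φ)
    rwa [eLpNorm_exponent_top] at this
  have h3 := coeFn_linftyInclusion (S' φ)
  rw [show linftyInclusion (S' φ) = T f from (hS' φ).trans (by rw [hφf])] at h3
  filter_upwards [h2, h3] with x hx2 hx3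
  rw [hx3]
  exact hx2.trans h1

/-- The integral of the rearrangement over `(0, t]`. -/
def rearrIntegral (f : L1) (t : ℝ) : ℝ := ∫ u in (0 : ℝ)..t, rearrFun f u

lemma integrable_rearrFun_volume (f : L1) : Integrable (rearrFun f) := by
  have h := integrable_rearrFun f
  have h2 : Integrable (rearr f) lam := h.congr (by
    filter_upwards [ae_lam_mem] with x hx
    exact rearrFun_of_mem f hx)
  exact (integrable_indicator_iff measurableSet_Ioc).2 h2

lemma integral_lam_eq {f : ℝ → ℝ} (hf : ∀ x, x ∉ Ioc (0 : ℝ) 1 → f x = 0) :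
    ∫ x, f x ∂lam = ∫ x, f x := setIntegral_eq_integral_of_forall_compl_eq_zero hf

lemma continuous_rearrIntegral (f : L1) : Continuous (rearrIntegral f) :=
  intervalIntegral.continuous_primitive
    (fun _ _ => (integrable_rearrFun_volume f).intervalIntegrable) 0

lemma rearrIntegral_sub (f : L1) (s t : ℝ) :
    rearrIntegral f t - rearrIntegral f s = ∫ u in s..t, rearrFun f u :=
  intervalIntegral.integral_interval_sub_left (integrable_rearrFun_volume f).intervalIntegrable
    (integrable_rearrFun_volume f).intervalIntegrable

lemma rearrIntegral_zero (f : L1) : rearrIntegral f 0 = 0 := intervalIntegral.integral_same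

lemma rearrIntegral_mono (f : L1) : Monotone (rearrIntegral f) := fun s t hst => by
  rw [← sub_nonneg, rearrIntegral_sub]
  exact intervalIntegral.integral_nonneg hst fun _ _ => rearrFun_nonneg f _

lemma mul_rearr_le_rearrIntegral_sub (f : L1) {s t : ℝ} (hs : 0 < s) (hst : s ≤ t)
    (ht : t ≤ 1) : (t - s) * rearr f t ≤ rearrIntegral f t - rearrIntegral f s := by
  rw [rearrIntegral_sub, ← smul_eq_mul, ← intervalIntegral.integral_const]
  refine intervalIntegral.integral_mono_on hst _root_.intervalIntegrable_const
    (integrable_rearrFun_volume f).intervalIntegrable fun x hx => ?_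
  rw [← rearrFun_of_mem f ⟨hs.trans_le hst, ht⟩]
  exact rearrFun_antitoneOn f (hs.trans_le hx.1) (hs.trans_le hst) hx.2

lemma integrable_truncation {f : ℝ → ℝ} (hf : Integrable f lam) (s : ℝ) :
    Integrable (fun x => max (|f x| - s) 0) lam :=
  (hf.abs.sub (integrable_const s)).pos_part

lemma integral_truncation_rearrFun (f : L1) {s : ℝ} (hs : 0 ≤ s) :
    ∫ x, max (|(f : ℝ → ℝ) x| - s) 0 ∂lam = ∫ x, max (rearrFun f x - s) 0 := by
  have h1 : ∫ x, max (|rearrFun f x| - s) 0 ∂lam = ∫ x, max (|(f : ℝ → ℝ) x| - s) 0 ∂lam :=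
    le_antisymm
      (integral_truncation_le_of_distr_le (integrable_rearrFun f) (L1.integrable f)
        (fun _ h => (lam_distr_rearrFun f h).le) hs)
      (integral_truncation_le_of_distr_le (L1.integrable f) (integrable_rearrFun f)
        (fun _ h => (lam_distr_rearrFun f h).ge) hs)
  simp only [abs_of_nonneg (rearrFun_nonneg f _)] at h1
  rw [← h1]
  refine integral_lam_eq fun x hx => ?_
  rw [rearrFun, indicator_of_notMem hx]
  simp [hs]

lemma integrable_truncation_rearrFun (f : L1) {s : ℝ} (hs : 0 ≤ s) :
    Integrable fun x => max (rearrFun f x - s) 0 := by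
  refine (integrable_rearrFun_volume f).mono'
    (((measurable_rearrFun f).sub_const s).max measurable_const).aestronglyMeasurable
    (Eventually.of_forall fun x => ?_)
  rw [Real.norm_eq_abs, abs_of_nonneg (le_max_right _ _)]
  exact max_le (by linarith) (rearrFun_nonneg f x)

/-- Any truncation level bounds the K-functional from above, since `f* ≤ s + (f* - s)⁺`. -/
lemma rearrIntegral_le_add_truncation (f : L1) {s t : ℝ} (hs : 0 ≤ s) (ht : 0 ≤ t) :
    rearrIntegral f t ≤ t * s + ∫ x, max (|(f : ℝ → ℝ) x| - s) 0 ∂lam := by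
  rw [integral_truncation_rearrFun f hs]
  have hi := integrable_truncation_rearrFun f hs
  have h1 : rearrIntegral f t ≤ ∫ u in (0 : ℝ)..t, (s + max (rearrFun f u - s) 0) := by
    refine intervalIntegral.integral_mono_on ht
      (integrable_rearrFun_volume f).intervalIntegrable
      (_root_.intervalIntegrable_const.add hi.intervalIntegrable) fun x _ => ?_
    linarith [le_max_left (rearrFun f x - s) 0]
  rw [intervalIntegral.integral_add _root_.intervalIntegrable_const hi.intervalIntegrable,
    intervalIntegral.integral_const, sub_zero, smul_eq_mul, intervalIntegral.integral_of_le ht] at h1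
  linarith [setIntegral_le_integral (s := Ioc 0 t) hi
    (Eventually.of_forall fun _ => le_max_right _ _)]

/-- The level `s = f*(t)` is optimal: `f*` is at least `s` on `(0, t]`, and `(f* - s)⁺` vanishes
beyond `t`. -/
lemma add_truncation_le_rearrIntegral (f : L1) {t : ℝ} (ht : 0 < t) (ht1 : t ≤ 1) :
    t * rearr f t + ∫ x, max (|(f : ℝ → ℝ) x| - rearr f t) 0 ∂lam ≤ rearrIntegral f t := by
  set s := rearr f t with hs
  have hs0 : 0 ≤ s := rearr_nonneg f t
  rw [integral_truncation_rearrFun f hs0]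
  have hi := integrable_truncation_rearrFun f hs0
  have h1 : ∫ x, max (rearrFun f x - s) 0 = ∫ u in (0 : ℝ)..t, max (rearrFun f u - s) 0 := by
    rw [intervalIntegral.integral_of_le ht.le]
    symm
    refine setIntegral_eq_integral_of_forall_compl_eq_zero fun x hx => ?_
    by_cases hx1 : x ∈ Ioc (0 : ℝ) 1
    · have htx : t ≤ x := (not_le.1 fun h => hx ⟨hx1.1, h⟩).le
      refine max_eq_right (sub_nonpos.2 ?_)
      rw [rearrFun_of_mem f hx1]
      exact rearr_antitoneOn f ht hx1.1 htx
    · rw [rearrFun, indicator_of_notMem hx1]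
      simp [hs0]
  rw [h1]
  have h2 : t * s = ∫ _ in (0 : ℝ)..t, s := by
    rw [intervalIntegral.integral_const, sub_zero, smul_eq_mul]
  rw [h2, ← intervalIntegral.integral_add _root_.intervalIntegrable_const hi.intervalIntegrable,
    rearrIntegral, intervalIntegral.integral_of_le ht.le, intervalIntegral.integral_of_le ht.le]
  refine setIntegral_mono_on
    ((integrable_const s).add hi.integrableOn)
    (integrable_rearrFun_volume f).integrableOn measurableSet_Ioc fun x hx => ?_
  have h3 : s ≤ rearrFun f x := by
    rw [rearrFun_of_mem f ⟨hx.1, hx.2.trans ht1⟩]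
    exact rearr_antitoneOn f hx.1 ht hx.2
  rw [max_eq_left (sub_nonneg.2 h3)]
  linarith

lemma abs_sub_clamp (a : ℝ) {s : ℝ} (hs : 0 ≤ s) :
    |a - max (-s) (min s a)| = max (|a| - s) 0 := by
  rcases le_total a (-s) with h | h
  · rw [max_eq_left ((min_le_right s a).trans h), abs_of_nonpos (by linarith : a ≤ 0),
      abs_of_nonpos (by linarith), max_eq_left (by linarith)]
    ring
  · rcases le_total a s with h' | h'
    · rw [min_eq_right h', max_eq_right h, sub_self, abs_zero,
        max_eq_right (sub_nonpos.2 (abs_le.2 ⟨h, h'⟩))]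
    · rw [min_eq_left h', max_eq_right (by linarith), abs_of_nonneg (sub_nonneg.2 h'),
        abs_of_nonneg (hs.trans h'), max_eq_left (sub_nonneg.2 h')]

lemma abs_clamp_le (a : ℝ) {s : ℝ} (hs : 0 ≤ s) : |max (-s) (min s a)| ≤ s :=
  abs_le.2 ⟨le_max_left _ _, max_le (by linarith) (min_le_left _ _)⟩

/-- An admissible operator increases the K-functional by at most a constant factor. -/
lemma IsAdmissible.exists_rearrIntegral_le {T : L1 →L[ℝ] L1} (hT : IsAdmissible T) :
    ∃ C : ℝ, 0 < C ∧ ∀ x : L1, ∀ t ∈ Icc (0 : ℝ) 1,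
      rearrIntegral (T x) t ≤ C * rearrIntegral x t := by
  obtain ⟨M, hM0, hM⟩ := hT.exists_bound
  refine ⟨max M ‖T‖ + 1, by positivity, fun x t ht => ?_⟩
  rcases ht.1.eq_or_lt with rfl | ht0
  · simp [rearrIntegral_zero]
  -- Splitting `x` at this height gives a bounded part, whose image is at most `M * s`, and a
  -- remainder of norm `∫ (|x| - s)⁺`.
  set s := rearr x t
  have hs : 0 ≤ s := rearr_nonneg x t
  have hxi := L1.integrable x
  have hci : Integrable (fun u => max (-s) (min s ((x : ℝ → ℝ) u))) lam :=
    Integrable.of_bound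
      ((measurable_const.max (measurable_const.min measurable_id)).comp_aemeasurable
        hxi.aemeasurable).aestronglyMeasurable s
      (Eventually.of_forall fun u => abs_clamp_le _ hs)
  set x₁ : L1 := hci.toL1 _ with hx₁
  have h₁ : (x₁ : ℝ → ℝ) =ᵐ[lam] fun u => max (-s) (min s ((x : ℝ → ℝ) u)) := hci.coeFn_toL1
  have hb : ∀ᵐ u ∂lam, |(T x₁ : ℝ → ℝ) u| ≤ M * s := by
    refine hM x₁ s hs ?_
    filter_upwards [h₁] with u hu
    rw [hu]
    exact abs_clamp_le _ hs
  have hnorm : ‖x - x₁‖ = ∫ u, max (|(x : ℝ → ℝ) u| - s) 0 ∂lam := by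
    rw [L1.norm_eq_integral_norm]
    refine integral_congr_ae ?_
    filter_upwards [h₁, Lp.coeFn_sub x x₁] with u hu1 hu2
    rw [hu2, Pi.sub_apply, hu1, Real.norm_eq_abs, abs_sub_clamp _ hs]
  have htr : ∫ u, max (|(T x : ℝ → ℝ) u| - M * s) 0 ∂lam ≤ ‖T (x - x₁)‖ := by
    rw [L1.norm_eq_integral_norm]
    refine integral_mono_ae (integrable_truncation (L1.integrable _) _)
      (L1.integrable _).norm ?_
    have h2 : T x - T x₁ = T (x - x₁) := (map_sub T x x₁).symm
    filter_upwards [hb, Lp.coeFn_sub (T x) (T x₁)] with u hu1 hu2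
    rw [h2] at hu2
    rw [hu2, Pi.sub_apply, Real.norm_eq_abs]
    refine max_le ?_ (abs_nonneg _)
    linarith [abs_sub_abs_le_abs_sub ((T x : ℝ → ℝ) u) ((T x₁ : ℝ → ℝ) u)]
  have hA := rearrIntegral_le_add_truncation (T x) (mul_nonneg hM0 hs) ht.1
  have hB := add_truncation_le_rearrIntegral x ht0 ht.2
  have hop := T.le_opNorm (x - x₁)
  have hI : 0 ≤ ∫ u, max (|(x : ℝ → ℝ) u| - s) 0 ∂lam := integral_nonneg fun _ => le_max_right _ _
  rw [hnorm] at hop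
  set I := ∫ u, max (|(x : ℝ → ℝ) u| - s) 0 ∂lam
  have hts : 0 ≤ t * s := mul_nonneg ht.1 hs
  have e1 : M * (t * s) ≤ (max M ‖T‖ + 1) * (t * s) :=
    mul_le_mul_of_nonneg_right (by linarith [le_max_left M ‖T‖]) hts
  have e2 : ‖T‖ * I ≤ (max M ‖T‖ + 1) * I :=
    mul_le_mul_of_nonneg_right (by linarith [le_max_right M ‖T‖]) hI
  have e3 : (max M ‖T‖ + 1) * (t * s + I) ≤ (max M ‖T‖ + 1) * rearrIntegral x t :=
    mul_le_mul_of_nonneg_left hB (by positivity)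
  linarith

/-! ### Sufficiency -/

/-- If `C * F` dominates `G`, the values of `G` are attained by `C * F` further to the left,
in a monotone way. -/
lemma exists_monotone_level {F G : ℝ → ℝ} (hF : Continuous F) (hG : Monotone G)
    (hF0 : F 0 = 0) (hG0 : G 0 = 0) {C : ℝ} (h : ∀ t ∈ Icc (0 : ℝ) 1, G t ≤ C * F t) :
    ∃ r : ℝ → ℝ, (∀ u ∈ Icc (0 : ℝ) 1, r u ∈ Icc 0 u ∧ C * F (r u) = G u) ∧
      MonotoneOn r (Icc 0 1) := by
  have hC : Continuous fun τ => C * F τ := continuous_const.mul hF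
  -- The least solution is taken because it is monotone in `u`: for `u ≤ v` the value `G u` is
  -- already attained on `[0, r v]`.
  have hex : ∀ u ∈ Icc (0 : ℝ) 1, ∃ τ, IsLeast (Icc 0 u ∩ {τ | C * F τ = G u}) τ := by
    intro u hu
    refine (isCompact_Icc.inter_right (isClosed_eq hC continuous_const)).exists_isLeast ?_
    obtain ⟨τ, hτ, hτ'⟩ := intermediate_value_Icc hu.1 hC.continuousOn
      (show G u ∈ Icc (C * F 0) (C * F u) from ⟨by
        rw [hF0, mul_zero, ← hG0]; exact hG hu.1, h u hu⟩)
    exact ⟨τ, hτ, hτ'⟩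
  choose! r hr using hex
  refine ⟨r, fun u hu => (hr u hu).1, fun u hu v hv huv => ?_⟩
  obtain ⟨hv1, hv2⟩ := (hr v hv).1
  have hv2 : C * F (r v) = G v := hv2
  rcases le_total u (r v) with huv' | huv'
  · exact (hr u hu).1.1.2.trans huv'
  obtain ⟨τ, hτ, hτ'⟩ := intermediate_value_Icc hv1.1 hC.continuousOn
    (show G u ∈ Icc (C * F 0) (C * F (r v)) from ⟨by
      rw [hF0, mul_zero, ← hG0]; exact hG hu.1, by rw [hv2]; exact hG huv⟩)
  exact ((hr u hu).2 ⟨⟨hτ.1, hτ.2.trans huv'⟩, hτ'⟩).trans hτ.2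

lemma volume_preimage_affine {c : ℝ} (hc : 0 < c) (b : ℝ) (A : Set ℝ) :
    volume ((fun t => c * (t - b)) ⁻¹' A) = ENNReal.ofReal c⁻¹ * volume A := by
  have : (fun t : ℝ => c * (t - b)) ⁻¹' A = (fun t => t + -b) ⁻¹' ((fun t => c * t) ⁻¹' A) := rfl
  rw [this, measure_preimage_add_right, Real.volume_preimage_mul_left hc.ne',
    abs_of_pos (inv_pos.2 hc)]

namespace IntervalPartition

variable (T : IntervalPartition)

/-- The weights `aₙ / (2 B tₙ₊₁)` sum to at most `1` over indices for which the `tₙ₊₁` lie within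
a factor two of the largest of them. -/
lemma tsum_weight_le_one {B : ℝ} (hB : ∀ n, T.pt n ≤ B * T.pt (n + 1)) (p : ℕ → Prop)
    (hp : ∀ m n, p m → p n → T.pt (m + 1) ≤ 2 * T.pt (n + 1)) [DecidablePred p] :
    ∑' n, (if p n then ENNReal.ofReal (T.stochasticVector n / (2 * B * T.pt (n + 1))) else 0)
      ≤ 1 := by
  have hB0 : 0 < B := pos_of_mul_pos_left ((T.pt_pos 0).trans_le (hB 0)) (T.pt_pos 1).le
  by_cases hex : ∃ n, p n
  · obtain ⟨N, hN, hmin⟩ : ∃ N, p N ∧ ∀ m, m < N → ¬ p m :=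
      ⟨Nat.find hex, Nat.find_spec hex, fun _ h => Nat.find_min hex h⟩
    rw [← Summable.sum_add_tsum_nat_add' (k := N) ENNReal.summable]
    have h0 : ∑ n ∈ Finset.range N, (if p n then ENNReal.ofReal
        (T.stochasticVector n / (2 * B * T.pt (n + 1))) else 0) = 0 :=
      Finset.sum_eq_zero fun n hn => if_neg (hmin n (Finset.mem_range.1 hn))
    rw [h0, zero_add]
    -- With `N` the least index, `tₙ₊₁ ≥ tN₊₁ / 2` for every contributing `n`. The weights are then
    -- at most `aₙ / (B tN₊₁)`, and the lengths from `N` on add up to `tN ≤ B tN₊₁`.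
    have hsum := (T.sum_stochasticVector N).div_const (B * T.pt (N + 1))
    have hpN := T.pt_pos (N + 1)
    calc ∑' k, (if p (k + N) then ENNReal.ofReal
          (T.stochasticVector (k + N) / (2 * B * T.pt (k + N + 1))) else 0)
        ≤ ∑' k, ENNReal.ofReal (T.stochasticVector (N + k) / (B * T.pt (N + 1))) := by
          refine ENNReal.tsum_le_tsum fun k => ?_
          split_ifs with hk
          · refine ENNReal.ofReal_le_ofReal ?_
            rw [add_comm k N] at hk ⊢
            refine div_le_div_of_nonneg_left (T.stochasticVector_pos _).le (by positivity) ?_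
            nlinarith [hp _ _ hN hk]
          · exact zero_le
      _ = ENNReal.ofReal (T.pt N / (B * T.pt (N + 1))) := by
          rw [← ENNReal.ofReal_tsum_of_nonneg
            (fun k => (div_pos (T.stochasticVector_pos _) (by positivity)).le) hsum.summable,
            hsum.tsum_eq]
      _ ≤ 1 := by
          rw [ENNReal.ofReal_le_one]
          exact div_le_one_of_le₀ (hB N) (by positivity)
  · rw [ENNReal.tsum_eq_zero.2 fun n => if_neg fun h => hex ⟨n, h⟩]
    exact zero_le

/-- If the end points decrease at most geometrically and `𝒯` averages the symmetric ideal `X`,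
then `X` is stable under domination of integrals of rearrangements. -/
lemma mem_of_rearrIntegral_le {B : ℝ} (hB : ∀ n, T.pt n ≤ B * T.pt (n + 1))
    {X : Submodule ℝ L1} (hX : IsSymmetricIdeal X) (hav : T.sigma.Averages X) {C : ℝ} (hC : 0 < C)
    {x y : L1} (hx : x ∈ X)
    (hxy : ∀ t ∈ Icc (0 : ℝ) 1, rearrIntegral y t ≤ C * rearrIntegral x t) : y ∈ X := by
  have hB0 : 0 < B := pos_of_mul_pos_left ((T.pt_pos 0).trans_le (hB 0)) (T.pt_pos 1).le
  have hB1 : 1 ≤ B := by nlinarith [hB 0, T.pt_succ_lt 0, T.pt_pos 1]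
  obtain ⟨r, hr, hrmono⟩ := exists_monotone_level (continuous_rearrIntegral x)
    (rearrIntegral_mono y) (rearrIntegral_zero x) (rearrIntegral_zero y) hxy
  set a := T.stochasticVector with ha
  set b : ℕ → ℝ := fun n => T.pt (n + 1) with hb
  have ha0 : ∀ n, 0 < a n := T.stochasticVector_pos
  have hb0 : ∀ n, 0 < b n := fun n => T.pt_pos _
  have hb1 : ∀ n, b n ≤ 1 := fun n => T.pt_le_one _
  have hbI : ∀ n, b n ∈ Icc (0 : ℝ) 1 := fun n => ⟨(hb0 n).le, hb1 n⟩
  have hb2I : ∀ n, b n / 2 ∈ Icc (0 : ℝ) 1 := fun n =>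
    ⟨by linarith [hb0 n], by linarith [hb0 n, hb1 n]⟩
  -- Over `A n` the function `x*` has integral `(G(b n) - G(b n / 2)) / C`; this is the mass to be
  -- moved into the `n`-th atom.
  set A : ℕ → Set ℝ := fun n => Ioc (r (b n / 2)) (r (b n)) with hA
  have hAsub : ∀ n, A n ⊆ Ioc 0 (b n) := fun n u hu =>
    ⟨(hr _ (hb2I n)).1.1.trans_lt hu.1, hu.2.trans (hr _ (hbI n)).1.2⟩
  -- The compression takes `(0, b n]` to an interval of length `a n / (2 * B) ≤ a n`, and `1 / c n`
  -- is exactly the weight in `tsum_weight_le_one`.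
  set c : ℕ → ℝ := fun n => 2 * B * b n / a n with hc
  have hc0 : ∀ n, 0 < c n := fun n => div_pos (by have := hb0 n; positivity) (ha0 n)
  set k : ℕ → ℝ → ℝ := fun n t => (A n).indicator (rearrFun x) (c n * (t - b n)) with hk
  have hkm : ∀ n, Measurable (k n) := fun n =>
    ((measurable_rearrFun x).indicator measurableSet_Ioc).comp
      (measurable_const.mul (measurable_id.sub_const _))
  have hk0 : ∀ n t, 0 ≤ k n t := fun n t => indicator_nonneg (fun _ _ => rearrFun_nonneg x _) _
  have hksupp : ∀ n t, t ∉ T.atom n → k n t = 0 := by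
    intro n t ht
    refine indicator_of_notMem (fun hmem => ht ?_) _
    have h1 := hAsub n hmem
    have h2 : 0 < t - b n := pos_of_mul_pos_right h1.1 (hc0 n).le
    have h3 : t - b n ≤ a n := by
      have h4 : c n * (t - b n) ≤ b n := h1.2
      rw [hc] at h4
      simp only at h4
      rw [div_mul_eq_mul_div, div_le_iff₀ (ha0 n)] at h4
      have h6 : 2 * B * (t - b n) ≤ a n :=
        le_of_mul_le_mul_left (by linarith) (hb0 n)
      nlinarith
    refine ⟨by change b n < t; linarith, ?_⟩
    have h5 : a n = T.pt n - b n := rfl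
    linarith
  obtain ⟨x', hx'm, hx'⟩ := T.exists_measurable_eqOn_atom k hkm
  have hdistr : ∀ s, 0 ≤ s → lam {t | s < |x' t|} ≤ lam {t | s < |(x : ℝ → ℝ) t|} := by
    intro s hs
    set S := {t | s < rearrFun x t} with hSdef
    have hSm : MeasurableSet S := measurableSet_lt measurable_const (measurable_rearrFun x)
    have hS01 : S ⊆ Ioc 0 1 := by
      rw [hSdef, setOf_lt_rearrFun x hs]
      exact inter_subset_right
    rw [← lam_lt_rearrFun x hs, ← hSdef, lam_apply hSm, inter_eq_left.2 hS01,
      T.lam_iUnion_inter_atom _ (measurableSet_lt measurable_const hx'm.abs)]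
    have hle : ∀ n, lam ({t | s < |x' t|} ∩ T.atom n) ≤
        ENNReal.ofReal (c n)⁻¹ * volume (A n ∩ S) := by
      intro n
      rw [← volume_preimage_affine (hc0 n) (b n), lam_apply
        ((measurableSet_lt measurable_const hx'm.abs).inter (T.measurableSet_atom n))]
      refine measure_mono fun t ht => ?_
      have h1 : s < |x' t| := ht.1.1
      rw [hx' n ht.1.2, abs_of_nonneg (hk0 n t)] at h1
      have hmem : c n * (t - b n) ∈ A n := by
        by_contra hcon
        rw [hk] at h1
        simp only [indicator_of_notMem hcon] at h1
        exact absurd hs (not_le.2 h1)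
      refine ⟨hmem, ?_⟩
      rw [hk] at h1
      change s < rearrFun x _
      simpa only [indicator_of_mem hmem] using h1
    calc ∑' n, lam ({t | s < |x' t|} ∩ T.atom n)
        ≤ ∑' n, ENNReal.ofReal (c n)⁻¹ * volume (A n ∩ S) := ENNReal.tsum_le_tsum hle
      _ = ∑' n, ∫⁻ u in S, (A n).indicator (fun _ => ENNReal.ofReal (c n)⁻¹) u := by
          refine tsum_congr fun n => ?_
          rw [lintegral_indicator_const measurableSet_Ioc,
            Measure.restrict_apply measurableSet_Ioc]
      _ = ∫⁻ u in S, ∑' n, (A n).indicator (fun _ => ENNReal.ofReal (c n)⁻¹) u := by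
          rw [lintegral_tsum fun n => (measurable_const.indicator measurableSet_Ioc).aemeasurable]
      _ ≤ ∫⁻ _ in S, 1 := by
          refine lintegral_mono fun u => ?_
          classical
          -- If `b n < b m / 2`, then monotonicity of `r` places `A n` entirely to the left of `A
          -- m`, so no `u` lies in both.
          have h1 := T.tsum_weight_le_one hB (fun n => u ∈ A n) fun m n hm hn => by
            by_contra! hlt
            have h2 : b n ≤ b m / 2 := by simp only [hb]; linarith
            have h3 := hrmono (hbI n) (hb2I m) h2
            exact absurd (hm.1.trans_le hn.2) (not_lt.2 h3)
          refine le_trans (le_of_eq (tsum_congr fun n => ?_)) h1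
          rw [indicator_apply, hc]
          simp only [inv_div]
          rfl
      _ = volume S := by rw [lintegral_const, Measure.restrict_apply_univ, one_mul]
  have hx'i : Integrable x' lam :=
    integrable_of_distr_le hx'm.aemeasurable (L1.integrable x) hdistr
  have hmem : hx'i.toL1 x' ∈ X := hX.mem_of_distr_le hx fun s hs => by
    rw [lam_distr_congr hx'i.coeFn_toL1]
    exact hdistr s hs
  have hmean : ∀ n, rearr y (b n) / (4 * B * C) ≤
      (∫ u in T.atom n, (hx'i.toL1 x' : ℝ → ℝ) u ∂lam) / a n := by
    intro n
    have hle : r (b n / 2) ≤ r (b n) := hrmono (hb2I n) (hbI n) (by linarith [hb0 n])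
    have h1 : ∫ u in T.atom n, (hx'i.toL1 x' : ℝ → ℝ) u ∂lam =
        (c n)⁻¹ * (rearrIntegral x (r (b n)) - rearrIntegral x (r (b n / 2))) := by
      rw [setIntegral_congr_ae (g := k n) (T.measurableSet_atom n) (by
          filter_upwards [hx'i.coeFn_toL1] with u hu hun
          rw [hu, hx' n hun]),
        T.lam_restrict_atom, setIntegral_eq_integral_of_forall_compl_eq_zero (hksupp n), hk]
      simp only
      rw [integral_sub_right_eq_self (fun t => (A n).indicator (rearrFun x) (c n * t)) (b n),
        Measure.integral_comp_mul_left, integral_indicator measurableSet_Ioc, smul_eq_mul,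
        abs_of_pos (inv_pos.2 (hc0 n)), rearrIntegral_sub, intervalIntegral.integral_of_le hle]
    have h2 : C * (rearrIntegral x (r (b n)) - rearrIntegral x (r (b n / 2))) =
        rearrIntegral y (b n) - rearrIntegral y (b n / 2) := by
      rw [mul_sub, (hr _ (hbI n)).2, (hr _ (hb2I n)).2]
    -- As `y*` is non-increasing, its integral over `(b n / 2, b n]` is at least `(b n / 2) y*(b
    -- n)`.
    have h3 := mul_rearr_le_rearrIntegral_sub y (s := b n / 2) (t := b n)
      (by linarith [hb0 n]) (by linarith [hb0 n]) (hb1 n)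
    rw [h1]
    set D := rearrIntegral x (r (b n)) - rearrIntegral x (r (b n / 2))
    have hbn := hb0 n
    have han := ha0 n
    have h4 : (c n)⁻¹ * D / a n = D / (2 * B * b n) := by
      rw [hc]
      field_simp
    rw [h4, div_le_div_iff₀ (by positivity) (by positivity)]
    have h5 : b n * rearr y (b n) ≤ 2 * (C * D) := by rw [h2]; linarith
    nlinarith
  set z : L1 := (4 * B * C) • T.sigma.average (hx'i.toL1 x') with hz
  have hzX : z ∈ X := X.smul_mem _ (hav _ hmem)
  have hyi := integrable_rearrFun y
  have hyX : hyi.toL1 _ ∈ X := by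
    refine hX.solid z hzX _ (abs_le_abs_of_ae ?_)
    filter_upwards [hyi.coeFn_toL1, Lp.coeFn_smul (4 * B * C) (T.sigma.average (hx'i.toL1 x')),
      T.average_ae_eq (hx'i.toL1 x'), T.ae_exists_mem_atom] with t h1 h2 h3 ⟨n, hn⟩
    rw [h1, hz, h2, Pi.smul_apply, h3 n hn, smul_eq_mul, abs_of_nonneg (rearrFun_nonneg y t)]
    refine le_trans ?_ (le_abs_self _)
    have h4 := hmean n
    rw [div_le_iff₀ (by positivity), mul_comm] at h4
    refine le_trans ?_ h4
    rw [rearrFun_of_mem y (T.atom_subset_Ioc n hn)]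
    exact rearr_antitoneOn y (hb0 n) (T.atom_subset_Ioc n hn).1 hn.1.le
  refine hX.mem_of_distr_le hyX fun s hs => ?_
  rw [lam_distr_congr hyi.coeFn_toL1, lam_distr_rearrFun y hs]

theorem isVerifying_of_bddAbove
    (h : BddAbove (Set.range fun n : ℕ => T.pt n / T.pt (n + 1))) : T.IsVerifying := by
  obtain ⟨B, hB⟩ := h
  have hB' : ∀ n, T.pt n ≤ B * T.pt (n + 1) := fun n =>
    (div_le_iff₀ (T.pt_pos _)).1 (hB ⟨n, rfl⟩)
  intro X hX hav
  refine ⟨hX.toIsOrderIdeal, hX.essBounded_mem, fun S hS x hx => ?_⟩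
  obtain ⟨C, hC, hle⟩ := hS.exists_rearrIntegral_le
  exact T.mem_of_rearrIntegral_le hB' hX hav hC hx (hle x)

end IntervalPartition

/-! ### Necessity -/

/-- The averaging operators are admissible. -/
lemma SigmaSubalgebra.exists_isAdmissible_eq_average (A : SigmaSubalgebra) :
    ∃ S : L1 →L[ℝ] L1, IsAdmissible S ∧ ∀ f, S f = A.average f := by
  have heq : ∀ f : L1, condExpL1CLM ℝ A.le_borel lam f = A.average f := by
    intro f
    refine Lp.ext ?_
    have h1 := condExp_ae_eq_condExpL1CLM (μ := lam) A.le_borel (L1.integrable f)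
    rw [Integrable.toL1_coeFn] at h1
    exact h1.symm.trans (Integrable.coeFn_toL1 integrable_condExp).symm
  refine ⟨condExpL1CLM ℝ A.le_borel lam, fun f hf => ?_, heq⟩
  obtain ⟨c, hc⟩ := (isEssBounded_iff f).1 hf
  rw [heq, isEssBounded_iff]
  refine ⟨c, ?_⟩
  filter_upwards [ae_bdd_abs_condExp_of_ae_bdd_abs (m := A.toMeasurableSpace) hc,
    Integrable.coeFn_toL1 (integrable_condExp (m := A.toMeasurableSpace) (μ := lam)
      (f := (f : ℝ → ℝ)))] with x h1 h2
  rw [SigmaSubalgebra.average, h2]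
  exact h1

/-- The integrable functions that, up to a constant, do not exceed `1 / α i` outside of a set of
measure `τ i`, for all `i`. -/
def gapIdeal (α τ : ℕ → ℝ) (hα : ∀ i, 0 < α i) (hτ : ∀ i, 0 < τ i) : Submodule ℝ L1 where
  carrier := {z | ∃ C : ℝ, 0 < C ∧
    ∀ i, lam {t | C / α i < |(z : ℝ → ℝ) t|} ≤ ENNReal.ofReal (C * τ i)}
  zero_mem' := by
    refine ⟨1, one_pos, fun i => ?_⟩
    have h : lam {t | 1 / α i < |((0 : L1) : ℝ → ℝ) t|} = 0 := by
      rw [measure_eq_zero_iff_ae_notMem]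
      filter_upwards [Lp.coeFn_zero ℝ 1 lam] with t ht
      rw [ht, Pi.zero_apply, abs_zero, not_lt]
      exact (div_pos one_pos (hα i)).le
    rw [h]
    exact zero_le
  -- One constant scales both the height and the measure of the exceptional set, so under addition
  -- the constants simply add.
  add_mem' := by
    rintro x y ⟨C, hC, hx⟩ ⟨D, hD, hy⟩
    refine ⟨C + D, add_pos hC hD, fun i => ?_⟩
    calc lam {t | (C + D) / α i < |((x + y : L1) : ℝ → ℝ) t|}
        ≤ lam ({t | C / α i < |(x : ℝ → ℝ) t|} ∪ {t | D / α i < |(y : ℝ → ℝ) t|}) := by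
          refine measure_mono_ae ?_
          filter_upwards [Lp.coeFn_add x y] with t ht h
          have h' : (C + D) / α i < |((x + y : L1) : ℝ → ℝ) t| := h
          rw [ht, Pi.add_apply, add_div] at h'
          change C / α i < |(x : ℝ → ℝ) t| ∨ D / α i < |(y : ℝ → ℝ) t|
          by_contra! hcon
          linarith [abs_add_le ((x : ℝ → ℝ) t) ((y : ℝ → ℝ) t), hcon.1, hcon.2]
      _ ≤ _ := measure_union_le _ _
      _ ≤ ENNReal.ofReal (C * τ i) + ENNReal.ofReal (D * τ i) := add_le_add (hx i) (hy i)
      _ = _ := by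
          rw [add_mul, ENNReal.ofReal_add (mul_pos hC (hτ i)).le (mul_pos hD (hτ i)).le]
  smul_mem' := by
    rintro c x ⟨C, hC, hx⟩
    refine ⟨(|c| + 1) * C, by positivity, fun i => ?_⟩
    calc lam {t | (|c| + 1) * C / α i < |((c • x : L1) : ℝ → ℝ) t|}
        ≤ lam {t | C / α i < |(x : ℝ → ℝ) t|} := by
          refine measure_mono_ae ?_
          filter_upwards [Lp.coeFn_smul c x] with t ht h
          have h' : (|c| + 1) * C / α i < |((c • x : L1) : ℝ → ℝ) t| := h
          rw [ht, Pi.smul_apply, smul_eq_mul, abs_mul, mul_div_assoc] at h'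
          change C / α i < |(x : ℝ → ℝ) t|
          refine lt_of_mul_lt_mul_left (a := |c| + 1) ?_ (by positivity)
          linarith [abs_nonneg ((x : ℝ → ℝ) t)]
      _ ≤ ENNReal.ofReal (C * τ i) := hx i
      _ ≤ _ := ENNReal.ofReal_le_ofReal (by
          have h1 := mul_pos hC (hτ i)
          nlinarith [abs_nonneg c])

lemma isSymmetricIdeal_gapIdeal {α τ : ℕ → ℝ} (hα : ∀ i, 0 < α i) (hτ : ∀ i, 0 < τ i)
    (hα1 : ∀ i, α i ≤ 1) : IsSymmetricIdeal (gapIdeal α τ hα hτ) where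
  essBounded_mem := by
    intro x hx
    obtain ⟨c, hc⟩ := (isEssBounded_iff x).1 hx
    refine ⟨max c 1, by positivity, fun i => ?_⟩
    have h : lam {t | max c 1 / α i < |(x : ℝ → ℝ) t|} = 0 := by
      rw [measure_eq_zero_iff_ae_notMem]
      filter_upwards [hc] with t ht
      rw [not_lt]
      exact (ht.trans (le_max_left c 1)).trans (le_div_self (by positivity) (hα i) (hα1 i))
    rw [h]
    exact zero_le
  solid := by
    rintro x ⟨C, hC, hx⟩ y hyx
    refine ⟨C, hC, fun i => le_trans (measure_mono_ae ?_) (hx i)⟩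
    filter_upwards [ae_of_abs_le_abs hyx] with t ht h
    exact lt_of_lt_of_le h ht
  symm_mem := by
    rintro x ⟨C, hC, hx⟩ y hyx
    exact ⟨C, hC, fun i => (distr_le_of_rearr_le hyx (div_pos hC (hα i)).le).trans (hx i)⟩

lemma lam_Ioc_zero_le (t : ℝ) : lam (Ioc 0 t) ≤ ENNReal.ofReal t := by
  rw [lam_apply measurableSet_Ioc]
  refine (measure_mono inter_subset_left).trans ?_
  rw [Real.volume_Ioc, sub_zero]

namespace IntervalPartition

variable (T : IntervalPartition)

/-- A monotonic partition averages even all of `L¹(I)` into a gap ideal that it gives rise to. -/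
lemma averages_gapIdeal (hT : T.IsMonotonic) (ν : ℕ → ℕ) :
    T.sigma.Averages (gapIdeal (fun i => T.stochasticVector (ν i)) (fun i => T.pt (ν i + 1))
      (fun _ => T.stochasticVector_pos _) fun _ => T.pt_pos _) := by
  intro z _
  set N := ∫ u, |(z : ℝ → ℝ) u| ∂lam with hN
  have hN0 : 0 ≤ N := integral_nonneg fun _ => abs_nonneg _
  refine ⟨N + 1, by positivity, fun i => ?_⟩
  have hanti : Antitone T.stochasticVector := antitone_nat_of_succ_le hT
  calc lam {t | (N + 1) / T.stochasticVector (ν i) < |(T.sigma.average z : ℝ → ℝ) t|}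
      ≤ lam (Ioc 0 (T.pt (ν i + 1))) := by
        refine measure_mono_ae ?_
        filter_upwards [T.average_ae_eq z, T.ae_exists_mem_atom] with t h1 ⟨m, hm⟩ h
        have h' : (N + 1) / T.stochasticVector (ν i) < |(T.sigma.average z : ℝ → ℝ) t| := h
        refine ⟨(T.pt_pos _).trans hm.1, hm.2.trans (T.strictAnti.antitone ?_)⟩
        -- On an atom of index at most `ν i`, monotonicity makes the length at least that of the
        -- atom `ν i`, so the mean is at most `N` divided by the latter.
        by_contra! hlt
        have h2 : |∫ u in T.atom m, (z : ℝ → ℝ) u ∂lam| ≤ N :=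
          (abs_integral_le_integral_abs).trans (setIntegral_le_integral (L1.integrable z).abs
            (Eventually.of_forall fun _ => abs_nonneg _))
        rw [h1 m hm, abs_div, abs_of_pos (T.stochasticVector_pos m)] at h'
        refine absurd h' (not_lt.2 ?_)
        exact div_le_div₀ (by positivity) (by linarith) (T.stochasticVector_pos _)
          (hanti (Nat.lt_succ_iff.1 hlt))
    _ ≤ ENNReal.ofReal (T.pt (ν i + 1)) := lam_Ioc_zero_le _
    _ ≤ _ := ENNReal.ofReal_le_ofReal (by
        have := T.pt_pos (ν i + 1)
        nlinarith)

/-- Finitely many ratios are bounded, so large ratios must occur arbitrarily close to `0`. -/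
lemma exists_gap (h : ¬ BddAbove (Set.range fun n : ℕ => T.pt n / T.pt (n + 1))) (R : ℝ)
    {ε : ℝ} (hε : 0 < ε) :
    ∃ n, R * T.pt (n + 1) ≤ T.stochasticVector n ∧ T.pt n ≤ ε := by
  by_contra! hcon
  obtain ⟨N, hN⟩ := eventually_atTop.1 (T.tendsto_zero.eventually (gt_mem_nhds hε))
  have hq : ∀ n, 0 ≤ T.pt n / T.pt (n + 1) := fun n => (div_pos (T.pt_pos _) (T.pt_pos _)).le
  refine h ⟨∑ n ∈ Finset.range N, T.pt n / T.pt (n + 1) + |R + 1|, ?_⟩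
  rintro _ ⟨n, rfl⟩
  have hS : 0 ≤ ∑ n ∈ Finset.range N, T.pt n / T.pt (n + 1) := Finset.sum_nonneg fun n _ => hq n
  rcases lt_or_ge n N with hn | hn
  · have := Finset.single_le_sum (f := fun n => T.pt n / T.pt (n + 1)) (fun n _ => hq n)
      (Finset.mem_range.2 hn)
    simp only at this ⊢
    linarith [abs_nonneg (R + 1)]
  · have h1 : T.stochasticVector n < R * T.pt (n + 1) := by
      by_contra! h2
      exact absurd (hN n hn).le (not_le.2 (hcon n h2))
    have h2 : T.pt n / T.pt (n + 1) ≤ R + 1 := by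
      rw [div_le_iff₀ (T.pt_pos _)]
      rw [stochasticVector] at h1
      linarith
    simp only
    linarith [le_abs_self (R + 1)]

lemma exists_gap_sequence (h : ¬ BddAbove (Set.range fun n : ℕ => T.pt n / T.pt (n + 1))) :
    ∃ ν : ℕ → ℕ, (∀ i, 16 ^ (i + 1) * T.pt (ν i + 1) ≤ T.stochasticVector (ν i)) ∧
      T.pt (ν 0) ≤ 1 / 2 ∧ ∀ i, T.pt (ν (i + 1)) ≤ T.pt (ν i + 1) / 2 := by
  have hex : ∀ (i : ℕ) (ε : ℝ), 0 < ε →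
      ∃ n, 16 ^ (i + 1) * T.pt (n + 1) ≤ T.stochasticVector n ∧ T.pt n ≤ ε :=
    fun i ε hε => T.exists_gap h _ hε
  choose! f hf using hex
  let ν : ℕ → ℕ := fun i => Nat.rec (f 0 (1 / 2)) (fun i n => f (i + 1) (T.pt (n + 1) / 2)) i
  have hν : ∀ i, ν (i + 1) = f (i + 1) (T.pt (ν i + 1) / 2) := fun _ => rfl
  refine ⟨ν, fun i => ?_, (hf 0 (1 / 2) (by norm_num)).2, fun i => ?_⟩
  · cases i with
    | zero => exact (hf 0 (1 / 2) (by norm_num)).1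
    | succ i => exact (hf (i + 1) _ (half_pos (T.pt_pos _))).1
  · rw [hν]
    exact (hf (i + 1) _ (half_pos (T.pt_pos _))).2

/-- A partition whose atoms are essentially larger than the `τ i`, but much smaller than
the `α i`. -/
lemma exists_coarse_partition {α τ : ℕ → ℝ} (hτ : ∀ i, 0 < τ i)
    (hgap : ∀ i, 16 ^ (i + 1) * τ i ≤ α i) (h0 : α 0 ≤ 1 / 2)
    (hsucc : ∀ i, α (i + 1) ≤ τ i / 2) :
    ∃ Q : IntervalPartition, (∀ i, Q.pt (i + 1) = 2 ^ (i + 1) * τ i) ∧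
      (∀ i, α i ≤ Q.pt i / 2) ∧ ∀ i, Q.pt (i + 1) ≤ α i / 8 := by
  -- The factor `2 ^ (i + 1)` outgrows every constant multiple of `τ i`, yet leaves a factor `8 ^ (i
  -- + 1)` below `α i`.
  let q : ℕ → ℝ := fun n => Nat.casesOn n 1 fun i => 2 ^ (i + 1) * τ i
  have hq0 : q 0 = 1 := rfl
  have hqs : ∀ i, q (i + 1) = 2 ^ (i + 1) * τ i := fun _ => rfl
  have hα : ∀ i, α i ≤ q i / 2 := by
    intro i
    cases i with
    | zero => rw [hq0]; exact h0
    | succ i =>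
      rw [hqs]
      have h1 : (1 : ℝ) ≤ 2 ^ (i + 1) := one_le_pow₀ (by norm_num)
      nlinarith [hsucc i, hτ i]
  have hqα : ∀ i, q (i + 1) ≤ α i / 8 := by
    intro i
    rw [hqs]
    have h1 : (8 : ℝ) * 2 ^ (i + 1) ≤ 16 ^ (i + 1) := by
      have : (16 : ℝ) = 8 * 2 := by norm_num
      rw [this, mul_pow]
      have h2 : (8 : ℝ) ≤ 8 ^ (i + 1) := le_self_pow₀ (by norm_num) (by omega)
      gcongr
    nlinarith [hgap i, hτ i]
  have hqpos : ∀ i, 0 < q i := by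
    intro i
    cases i with
    | zero => rw [hq0]; exact one_pos
    | succ i => rw [hqs]; exact mul_pos (by positivity) (hτ i)
  have hhalf : ∀ i, q (i + 1) ≤ q i * (1 / 2) := fun i => by
    linarith [hα i, hqα i, hqpos i]
  have hgeom : ∀ i, q i ≤ (1 / 2) ^ i := by
    intro i
    induction i with
    | zero => rw [hq0, pow_zero]
    | succ i ih => rw [pow_succ]; linarith [hhalf i]
  exact ⟨⟨q, hq0, strictAnti_nat_of_succ_lt fun i => by linarith [hhalf i, hqpos i],
    squeeze_zero (fun i => (hqpos i).le) hgeom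
      (tendsto_pow_atTop_nhds_zero_of_lt_one (by norm_num) (by norm_num))⟩, hqs, hα, hqα⟩

/-- A function with a peak of width `d n` and mass `2⁻ⁿ` at the left end of each atom. -/
lemma exists_peaks {d : ℕ → ℝ} (hd : ∀ n, 0 < d n) (hd' : ∀ n, T.pt (n + 1) + d n ≤ T.pt n) :
    ∃ x : L1, (∀ n, ∫ u in T.atom n, (x : ℝ → ℝ) u ∂lam = (1 / 2) ^ n) ∧
      ∀ᵐ t ∂lam, ∀ n, t ∈ T.atom n → (x : ℝ → ℝ) t =
        (Ioc (T.pt (n + 1)) (T.pt (n + 1) + d n)).indicator (fun _ => (1 / 2) ^ n / d n) t := by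
  set k : ℕ → ℝ → ℝ := fun n =>
    (Ioc (T.pt (n + 1)) (T.pt (n + 1) + d n)).indicator fun _ => (1 / 2) ^ n / d n with hk
  obtain ⟨f, hfm, hf⟩ := T.exists_measurable_eqOn_atom k fun n =>
    measurable_const.indicator measurableSet_Ioc
  have hk0 : ∀ n t, 0 ≤ k n t := fun n t =>
    indicator_nonneg (fun _ _ => (div_pos (by positivity) (hd n)).le) _
  have hki : ∀ n, Integrable (k n) lam := fun n =>
    (integrable_const _).indicator measurableSet_Ioc
  have hkint : ∀ n, ∫ u in T.atom n, k n u ∂lam = (1 / 2) ^ n := by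
    intro n
    rw [T.lam_restrict_atom, hk]
    simp only
    rw [setIntegral_indicator measurableSet_Ioc, atom, inter_eq_right.2
      (Ioc_subset_Ioc_right (hd' n)), setIntegral_const, Measure.real, Real.volume_Ioc,
      add_sub_cancel_left, ENNReal.toReal_ofReal (hd n).le, smul_eq_mul,
      mul_div_cancel₀ _ (hd n).ne']
  have hfi : Integrable f lam := by
    have hint : IntegrableOn f (⋃ n, T.atom n) lam := by
      refine integrableOn_iUnion_of_summable_integral_norm (fun n => ?_) ?_
      · exact (hki n).integrableOn.congr_fun (hf n).symm (T.measurableSet_atom n)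
      · have h1 : ∀ n, ∫ u in T.atom n, ‖f u‖ ∂lam = (1 / 2) ^ n := by
          intro n
          rw [← hkint n]
          refine setIntegral_congr_fun (T.measurableSet_atom n) fun t ht => ?_
          rw [hf n ht, Real.norm_eq_abs, abs_of_nonneg (hk0 n t)]
        simp only [h1]
        exact summable_geometric_two
    rw [T.iUnion_atom] at hint
    have : lam.restrict (Ioc 0 1) = lam := by
      rw [lam, Measure.restrict_restrict measurableSet_Ioc, inter_self]
    rwa [IntegrableOn, this] at hint
  refine ⟨hfi.toL1 f, fun n => ?_, ?_⟩
  · rw [← hkint n]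
    refine setIntegral_congr_ae (T.measurableSet_atom n) ?_
    filter_upwards [hfi.coeFn_toL1] with t ht htn
    rw [ht, hf n htn]
  · filter_upwards [hfi.coeFn_toL1] with t ht n htn
    rw [ht, hf n htn]

/-- A gap ideal of a rapidly decreasing sequence of gaps is not majorant. -/
lemma not_isMajorantIdeal_gapIdeal {α τ : ℕ → ℝ} (hα : ∀ i, 0 < α i) (hτ : ∀ i, 0 < τ i)
    (hgap : ∀ i, 16 ^ (i + 1) * τ i ≤ α i) (h0 : α 0 ≤ 1 / 2)
    (hsucc : ∀ i, α (i + 1) ≤ τ i / 2) : ¬ IsMajorantIdeal (gapIdeal α τ hα hτ) := by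
  rintro ⟨-, -, hmap⟩
  obtain ⟨Q, hQ, hαQ, hQα⟩ := exists_coarse_partition hτ hgap h0 hsucc
  obtain ⟨x, hxint, hx⟩ := Q.exists_peaks hα fun n => by linarith [hαQ n, hQα n, Q.pt_pos n]
  have hτα : ∀ i, τ i ≤ α i := fun i => by
    have h1 : (1 : ℝ) ≤ 16 ^ (i + 1) := one_le_pow₀ (by norm_num)
    nlinarith [hgap i, hτ i]
  have hαanti : Antitone α := antitone_nat_of_succ_le fun i => by
    linarith [hsucc i, hτα i, hτ i]
  have hτanti : Antitone τ := antitone_nat_of_succ_le fun i => by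
    linarith [hsucc i, hτα (i + 1), hτ i]
  have hxX : x ∈ gapIdeal α τ hα hτ := by
    refine ⟨1, one_pos, fun i => ?_⟩
    rw [one_mul]
    refine le_trans (measure_mono_ae ?_) (lam_Ioc_zero_le (τ i))
    filter_upwards [hx, Q.ae_exists_mem_atom] with t h1 ⟨m, hm⟩ h
    have h' : 1 / α i < |(x : ℝ → ℝ) t| := h
    rw [h1 m hm] at h'
    by_cases hmem : t ∈ Ioc (Q.pt (m + 1)) (Q.pt (m + 1) + α m)
    · have hp : (0 : ℝ) < (1 / 2) ^ m := by positivity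
      rw [indicator_of_mem hmem, abs_of_pos (div_pos hp (hα m))] at h'
      -- The `m`-th peak has height `2⁻ᵐ / α m`, so only peaks with `m > i` exceed `1 / α i`. These
      -- lie in `(0, τ i]`, since `Q.pt (m + 1) + α m ≤ (9/8) α m` and `α m ≤ τ (m - 1) / 2`.
      have him : i < m := by
        by_contra! hmi
        exact absurd h' (not_lt.2 (div_le_div₀ zero_le_one
          (pow_le_one₀ (by norm_num) (by norm_num)) (hα i) (hαanti hmi)))
      obtain ⟨j, rfl⟩ := Nat.exists_eq_succ_of_ne_zero (Nat.ne_zero_of_lt him)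
      refine ⟨(Q.pt_pos _).trans hm.1, hmem.2.trans ?_⟩
      have h2 := hQα (j + 1)
      have h3 := hsucc j
      have h4 := hτanti (Nat.lt_succ_iff.1 him)
      have h5 := hτ j
      simp only [Nat.succ_eq_add_one] at h2 ⊢
      linarith
    · rw [indicator_of_notMem hmem, abs_zero] at h'
      exact absurd h' (not_lt.2 (div_pos one_pos (hα i)).le)
  obtain ⟨S, hS, hSQ⟩ := Q.sigma.exists_isAdmissible_eq_average
  have hy := hmap S hS x hxX
  rw [hSQ] at hy
  obtain ⟨C, hC, hyC⟩ := hy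
  obtain ⟨k, hk⟩ := pow_unbounded_of_one_lt C (one_lt_two (α := ℝ))
  have hτk := hτ k
  -- On this atom the mean is at least `2⁻⁽ᵏ⁺¹⁾ / (2ᵏ⁺¹ τ k) ≥ 4ᵏ⁺¹ / α k`, which exceeds `C / α k`;
  -- so the atom is contained in the exceptional set.
  have h1 : lam (Q.atom (k + 1)) ≤ ENNReal.ofReal (C * τ k) := by
    refine le_trans (measure_mono_ae ?_) (hyC k)
    filter_upwards [Q.average_ae_eq x] with t ht hm
    change C / α k < |(Q.sigma.average x : ℝ → ℝ) t|
    rw [ht (k + 1) hm, hxint]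
    refine lt_of_lt_of_le ?_ (le_abs_self _)
    have hv := Q.stochasticVector_pos (k + 1)
    have hv' : Q.stochasticVector (k + 1) ≤ 2 ^ (k + 1) * τ k := by
      rw [← hQ k, stochasticVector]
      linarith [Q.pt_pos (k + 1 + 1)]
    refine lt_of_lt_of_le ?_ (div_le_div_of_nonneg_left (by positivity) hv hv')
    rw [div_lt_div_iff₀ (hα k) (by positivity)]
    have e1 : C * (2 ^ (k + 1) * τ k) < 2 ^ k * (2 ^ (k + 1) * τ k) := by gcongr
    have e2 : (2 : ℝ) ^ k * (2 ^ (k + 1) * τ k) ≤ (1 / 2) ^ (k + 1) * (16 ^ (k + 1) * τ k) := by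
      have e3 : (1 / 2 : ℝ) ^ (k + 1) * 16 ^ (k + 1) = 2 ^ (k + 1) * (2 ^ (k + 1) * 2 ^ (k + 1)) := by
        rw [← mul_pow, ← mul_pow, ← mul_pow]; norm_num
      rw [← mul_assoc, ← mul_assoc, e3]
      have e4 : (1 : ℝ) ≤ 2 ^ (k + 1) := one_le_pow₀ (by norm_num)
      have e5 : (2 : ℝ) ^ k ≤ 2 ^ (k + 1) := pow_le_pow_right₀ (by norm_num) (by omega)
      refine mul_le_mul_of_nonneg_right ?_ hτk.le
      calc (2 : ℝ) ^ k * 2 ^ (k + 1) ≤ 2 ^ (k + 1) * 2 ^ (k + 1) := by gcongr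
        _ ≤ 2 ^ (k + 1) * (2 ^ (k + 1) * 2 ^ (k + 1)) := by
          gcongr
          exact le_mul_of_one_le_left (by positivity) e4
    refine (e1.trans_le e2).trans_le ?_
    exact mul_le_mul_of_nonneg_left (hgap k) (by positivity)
  rw [Q.lam_atom, ENNReal.ofReal_le_ofReal_iff (by positivity), stochasticVector, hQ] at h1
  -- The contradiction: the atom has length at least `2ᵏ⁺¹ τ k - τ k / 16`, which is more than `2ᵏ τ
  -- k > C τ k`.
  have h2 := hQα (k + 1)
  have h3 := hsucc k
  have h4 : C * τ k < 2 ^ k * τ k := by gcongr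
  have h5 : (1 : ℝ) ≤ 2 ^ k := one_le_pow₀ (by norm_num)
  rw [pow_succ] at h1
  nlinarith

theorem bddAbove_of_isVerifying (hT : T.IsMonotonic) (hv : T.IsVerifying) :
    BddAbove (Set.range fun n : ℕ => T.pt n / T.pt (n + 1)) := by
  by_contra h
  obtain ⟨ν, hgap, h0, hsucc⟩ := T.exists_gap_sequence h
  have hle : ∀ n, T.stochasticVector n ≤ T.pt n := fun n => by
    rw [stochasticVector]
    linarith [T.pt_pos (n + 1)]
  refine not_isMajorantIdeal_gapIdeal (fun i => T.stochasticVector_pos (ν i))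
    (fun i => T.pt_pos (ν i + 1)) hgap ((hle _).trans h0) (fun i => (hle _).trans (hsucc i)) ?_
  exact hv _ (isSymmetricIdeal_gapIdeal _ _ fun i => (hle _).trans (T.pt_le_one _))
    (T.averages_gapIdeal hT ν)

/-- The tail sums telescope to `tₙ₊₁`, so the two ratios differ by exactly one. -/
lemma bddAbove_stochasticVector_div_iff :
    BddAbove (Set.range fun n : ℕ =>
        T.stochasticVector n / ∑' k : ℕ, T.stochasticVector (n + 1 + k)) ↔
      BddAbove (Set.range fun n : ℕ => T.pt n / T.pt (n + 1)) := by
  have h : ∀ n, T.stochasticVector n / ∑' k : ℕ, T.stochasticVector (n + 1 + k) =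
      T.pt n / T.pt (n + 1) - 1 := fun n => by
    rw [(T.sum_stochasticVector (n + 1)).tsum_eq, stochasticVector, sub_div,
      div_self (T.pt_pos _).ne']
  simp only [h]
  constructor
  · rintro ⟨B, hB⟩
    refine ⟨B + 1, ?_⟩
    rintro _ ⟨n, rfl⟩
    linarith [hB ⟨n, rfl⟩]
  · rintro ⟨B, hB⟩
    refine ⟨B - 1, ?_⟩
    rintro _ ⟨n, rfl⟩
    linarith [hB ⟨n, rfl⟩]

end IntervalPartition

end

end AveragingIdeals

open AveragingIdeals in
theorem theorem6p4 (T : IntervalPartition) :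
    -- the tails of the stochastic vector converge, and the `n`-th tail is the `n`-th end point
    (∀ n : ℕ, HasSum (fun k : ℕ => T.stochasticVector (n + 1 + k)) (T.pt (n + 1))) ∧
    -- the two forms of the condition are equivalent
    (BddAbove (Set.range fun n : ℕ =>
        T.stochasticVector n / ∑' k : ℕ, T.stochasticVector (n + 1 + k)) ↔
      BddAbove (Set.range fun n : ℕ => T.pt n / T.pt (n + 1))) ∧
    -- sufficiency
    (BddAbove (Set.range fun n : ℕ => T.pt n / T.pt (n + 1)) → T.IsVerifying) ∧
    -- necessity for monotonic stochastic vectors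
    (T.IsMonotonic → T.IsVerifying →
      BddAbove (Set.range fun n : ℕ => T.pt n / T.pt (n + 1))) :=
  ⟨fun n => T.sum_stochasticVector (n + 1), T.bddAbove_stochasticVector_div_iff,
    T.isVerifying_of_bddAbove, T.bddAbove_of_isVerifying⟩
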